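/- Let $n\ge 0$ and let $M\in GL_n=GL_n(\mathbb R)$ be a semisimple matrix each of whose negative eigenvalues (if any) has even multiplicity. Denote its eigenvalues as follows (any of the families may be empty): - the distinct positive eigenvalues $\lambda_1<\dots<\lambda_p$, with multiplicities $h_1,\dots,h_p$; - the distinct non-real eigenvalues $\rho_{lt}\,e^{\pm \mathbf i\theta_l}$ ($1\le l\le r$, $1\le t\le s_l$), both with multiplicity $m_{lt}$, where $0<\theta_1<\dots<\theta_r<\pi$ and $0<\rho_{l1}<\dots<\rho_{ls_l}$ for every $l$; - the distinct negative eigenvalues $-\zeta_1>\dots>-\zeta_q$, with multiplicities $2k_1,\dots,2k_q$. Put $E_\theta=\begin{pmatrix}\cos\theta&-\sin\theta\\ \sin\theta&\cos\theta\end{pmatrix}$, write $\oplus$ for block diagonal sums, and let $$\mathcal J_M=\Big(\bigoplus_{i=1}^p\lambda_iI_{h_i}\Big)\oplus\Big(\bigoplus_{l=1}^r\bigoplus_{t=1}^{s_l}\rho_{lt}E_{\theta_l}^{\oplus m_{lt}}\Big)\oplus\Big(\bigoplus_{i=1}^q(-\zeta_i)I_{2k_i}\Big)$$ be the real Jordan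 standard form of $M$. Let $C\in GL_n$ be such that $M=C\mathcal J_MC^{-1}$. For $B\in GL_n$ let $\mathcal C_B=\{X\in GL_n: BX=XB\}$, a closed Lie subgroup of $GL_n$, and let $\widehat\Gamma_C(A)=CAC^{-1}$. Fix integers $0\le u_i\le h_i$ ($1\le i\le p$) and $0\le\mu_{lt}\le m_{lt}$ ($1\le l\le r$, $1\le t\le s_l$), and put $v_i=h_i-u_i$, $\nu_{lt}=m_{lt}-\mu_{lt}$. Let $\mathcal{SR}(M)_{(u)}^{(\mu)}$ be the set of the real $n\times n$ matrices $Y$ with $Y^2=M$ whose eigenvalues are: $\sqrt{\lambda_i}$ with multiplicity $u_i$ and $-\sqrt{\lambda_i}$ with multiplicity $v_i$; $\sqrt{\rho_{lt}}\,e^{\pm\mathbf i\theta_l/2}$ both with multiplicity $\mu_{lt}$ and $\sqrt{\rho_{lt}}\,e^{\pm\mathbf i(\theta_l/2-\pi)}$ both with multiplicity $\nu_{lt}$; $\pm\mathbf i\sqrt{\zeta_i}$ both with multiplicity $k_i$. Let $$\widetilde{\mathcal J}=\Big(\bigoplus_{i=1}^p\sqrt{\lambda_i}\,(I_{u_i}\oplus(-I_{v_i}))\Big)\oplus\Big(\bigoplus_{l=1}^r\bigoplus_{t=1}^{s_l}\sqrt{\rho_{lt}}\,\big(E_{\theta_l/2}^{\oplus\mu_{lt}}\oplus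 E_{\theta_l/2-\pi}^{\oplus\nu_{lt}}\big)\Big)\oplus\Big(\bigoplus_{i=1}^q\sqrt{\zeta_i}\,E_{\pi/2}^{\oplus k_i}\Big).$$ Then $$\mathcal{SR}(M)_{(u)}^{(\mu)}=\{CX\widetilde{\mathcal J}X^{-1}C^{-1}:X\in\mathcal C_{\mathcal J_M}\}=\widehat\Gamma_C\big(\{X\widetilde{\mathcal J}X^{-1}:X\in\mathcal C_{\mathcal J_M}\}\big).$$ Moreover $\mathcal{SR}(M)_{(u)}^{(\mu)}$ is contained in $GL_n$ and is a closed embedded submanifold of $GL_n$; $\mathcal C_{\widetilde{\mathcal J}}\subseteq\mathcal C_{\mathcal J_M}$; and $\mathcal{SR}(M)_{(u)}^{(\mu)}$ is diffeomorphic to the homogeneous space $\mathcal C_{\mathcal J_M}/\mathcal C_{\widetilde{\mathcal J}}$. -/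

import Mathlib

open scoped Manifold ContDiff MatrixGroups Matrix.Norms.L2Operator

noncomputable section

namespace SqrtStrata

/-- The multiplicity (algebraic, `0` for non-eigenvalues) of `z : ℂ` as an eigenvalue of the
real matrix `A`. -/
def mult {n : ℕ} (A : Matrix (Fin n) (Fin n) ℝ) (z : ℂ) : ℕ :=
  (A.charpoly.map (algebraMap ℝ ℂ)).rootMultiplicity z

open Classical in
/-- The distinct complex eigenvalues of `A`. -/
def spec {n : ℕ} (A : Matrix (Fin n) (Fin n) ℝ) : Finset ℂ :=
  (A.charpoly.map (algebraMap ℝ ℂ)).roots.toFinset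

open Classical in
/-- The distinct positive eigenvalues. -/
def posEig {n : ℕ} (A : Matrix (Fin n) (Fin n) ℝ) : Finset ℝ :=
  ((spec A).filter fun z => z.im = 0 ∧ 0 < z.re).image Complex.re

open Classical in
/-- The absolute values of the distinct negative eigenvalues. -/
def negEig {n : ℕ} (A : Matrix (Fin n) (Fin n) ℝ) : Finset ℝ :=
  ((spec A).filter fun z => z.im = 0 ∧ z.re < 0).image fun z => -z.re

open Classical in
/-- The distinct eigenvalues with positive imaginary part. -/
def upperEig {n : ℕ} (A : Matrix (Fin n) (Fin n) ℝ) : Finset ℂ :=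
  (spec A).filter fun z => 0 < z.im

open Classical in
/-- The distinct arguments of the eigenvalues with positive imaginary part. -/
def upperArgs {n : ℕ} (A : Matrix (Fin n) (Fin n) ℝ) : Finset ℝ :=
  (upperEig A).image Complex.arg

open Classical in
/-- The distinct moduli of the eigenvalues with positive imaginary part and argument `t`. -/
def upperNorms {n : ℕ} (A : Matrix (Fin n) (Fin n) ℝ) (t : ℝ) : Finset ℝ :=
  ((upperEig A).filter fun z => z.arg = t).image fun z => ‖z‖

/-- A list of eigenvalues with multiplicities: `lam i` with multiplicity `h i`,
`rho l t * exp (± I * theta l)` both with multiplicity `m l t`, and `- zeta i` with multiplicity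
`2 * k i`. -/
structure EigData where
  p : ℕ
  lam : Fin p → ℝ
  h : Fin p → ℕ
  r : ℕ
  theta : Fin r → ℝ
  s : Fin r → ℕ
  rho : ∀ l : Fin r, Fin (s l) → ℝ
  m : ∀ l : Fin r, Fin (s l) → ℕ
  q : ℕ
  zeta : Fin q → ℝ
  k : Fin q → ℕ

/-- The eigenvalues of `A`, each of the families `lam`, `theta`, `rho l`, `zeta` being listed
in strictly increasing order. -/
def eigData {n : ℕ} (A : Matrix (Fin n) (Fin n) ℝ) : EigData where
  p := (posEig A).card
  lam := (posEig A).orderEmbOfFin rfl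
  h := fun i => mult A (((posEig A).orderEmbOfFin rfl i : ℝ) : ℂ)
  r := (upperArgs A).card
  theta := (upperArgs A).orderEmbOfFin rfl
  s := fun l => (upperNorms A ((upperArgs A).orderEmbOfFin rfl l)).card
  rho := fun l => (upperNorms A ((upperArgs A).orderEmbOfFin rfl l)).orderEmbOfFin rfl
  m := fun l t => mult A
    ((((upperNorms A ((upperArgs A).orderEmbOfFin rfl l)).orderEmbOfFin rfl t : ℝ) : ℂ) *
      Complex.exp (Complex.I * (((upperArgs A).orderEmbOfFin rfl l : ℝ) : ℂ)))
  q := (negEig A).card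
  zeta := (negEig A).orderEmbOfFin rfl
  k := fun i => mult A (((-(negEig A).orderEmbOfFin rfl i : ℝ) : ℝ) : ℂ) / 2

/-- The matrix `E_θ` of the rotation by the angle `θ`. -/
def rot (θ : ℝ) : Matrix (Fin 2) (Fin 2) ℝ :=
  !![Real.cos θ, -Real.sin θ; Real.sin θ, Real.cos θ]

namespace EigData

/-- The total number of listed eigenvalues, counted with multiplicity. -/
def order (D : EigData) : ℕ :=
  ∑ i, D.h i + 2 * ∑ l, ∑ t, D.m l t + 2 * ∑ i, D.k i

/-- Positions of the rows and columns of the block diagonal matrices below. -/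
abbrev Idx (D : EigData) : Type :=
  (Σ i : Fin D.p, Fin (D.h i)) ⊕
    ((Σ l : Fin D.r, Σ t : Fin (D.s l), Σ _ : Fin (D.m l t), Fin 2) ⊕
      (Σ i : Fin D.q, Σ _ : Fin (D.k i), Fin 2))

/-- The enumeration of the positions in their natural (lexicographic) order. -/
def idxEquiv (D : EigData) {n : ℕ} (hD : D.order = n) : D.Idx ≃ Fin n :=
  (Equiv.sumCongr finSigmaFinEquiv
    ((Equiv.sumCongr
      ((Equiv.sigmaCongrRight fun _ =>
        (Equiv.sigmaCongrRight fun _ => finSigmaFinEquiv).trans finSigmaFinEquiv).trans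
          finSigmaFinEquiv)
      ((Equiv.sigmaCongrRight fun _ => finSigmaFinEquiv).trans finSigmaFinEquiv)).trans
        finSumFinEquiv)).trans
    (finSumFinEquiv.trans (finCongr (by
      rw [← hD, order]
      simp only [Finset.sum_const, Finset.card_univ, Fintype.card_fin, smul_eq_mul,
        ← Finset.sum_mul]
      ring)))

/-- The direct sum of the blocks `A i` (of order `h i`), then of the `2 × 2` blocks `B l t j`,
then of the `2 × 2` blocks `N i j`, as a matrix of order `n`. -/
def directSum (D : EigData) {n : ℕ} (hD : D.order = n)
    (A : ∀ i, Matrix (Fin (D.h i)) (Fin (D.h i)) ℝ)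
    (B : ∀ l t, Fin (D.m l t) → Matrix (Fin 2) (Fin 2) ℝ)
    (N : ∀ i, Fin (D.k i) → Matrix (Fin 2) (Fin 2) ℝ) :
    Matrix (Fin n) (Fin n) ℝ :=
  Matrix.reindex (D.idxEquiv hD) (D.idxEquiv hD)
    (Matrix.fromBlocks (Matrix.blockDiagonal' A) 0 0
      (Matrix.fromBlocks
        (Matrix.blockDiagonal' fun l => Matrix.blockDiagonal' fun t =>
          Matrix.blockDiagonal' (B l t)) 0 0
        (Matrix.blockDiagonal' fun i => Matrix.blockDiagonal' (N i))))

/-- `(⨁ λ_i I_{h_i}) ⊕ (⨁ ρ_{lt} E_{θ_l}^{⊕ m_{lt}}) ⊕ (⨁ (-ζ_i) I_{2 k_i})`. -/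
def jordan (D : EigData) {n : ℕ} (hD : D.order = n) : Matrix (Fin n) (Fin n) ℝ :=
  D.directSum hD (fun i => D.lam i • (1 : Matrix (Fin (D.h i)) (Fin (D.h i)) ℝ)) (fun l t _ => D.rho l t • rot (D.theta l))
    (fun i _ => (-D.zeta i) • (1 : Matrix (Fin 2) (Fin 2) ℝ))

/-- `(⨁ √λ_i (I_{u_i} ⊕ -I_{h_i - u_i}))`, then
`⨁ √ρ_{lt} (E_{θ_l / 2}^{⊕ μ_{lt}} ⊕ E_{θ_l / 2 - π}^{⊕ (m_{lt} - μ_{lt})})`, then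
`⨁ √ζ_i E_{π / 2}^{⊕ k_i}`. -/
def aux (D : EigData) {n : ℕ} (hD : D.order = n) (u : Fin D.p → ℕ)
    (μ : ∀ l, Fin (D.s l) → ℕ) : Matrix (Fin n) (Fin n) ℝ :=
  D.directSum hD
    (fun i => √(D.lam i) •
      Matrix.diagonal fun j : Fin (D.h i) => if (j : ℕ) < u i then (1 : ℝ) else -1)
    (fun l t j => √(D.rho l t) •
      if (j : ℕ) < μ l t then rot (D.theta l / 2) else rot (D.theta l / 2 - Real.pi))
    (fun i _ => √(D.zeta i) • rot (Real.pi / 2))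

end EigData

theorem mem_spec {n : ℕ} (A : Matrix (Fin n) (Fin n) ℝ) (z : ℂ) :
    z ∈ spec A ↔ (A.charpoly.map (algebraMap ℝ ℂ)).IsRoot z := by
  classical
  have h0 : A.charpoly.map (algebraMap ℝ ℂ) ≠ 0 := (A.charpoly_monic.map _).ne_zero
  simp [spec, h0]

theorem mult_conj {n : ℕ} (A : Matrix (Fin n) (Fin n) ℝ) (z : ℂ) :
    mult A (starRingEnd ℂ z) = mult A z := by
  unfold mult
  have h := Polynomial.eq_rootMultiplicity_map (p := A.charpoly.map (algebraMap ℝ ℂ))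
    (f := starRingEnd ℂ) (starRingEnd ℂ).injective z
  rw [h, Polynomial.map_map]
  congr 2
  ext x
  simp

theorem conj_mem_spec {n : ℕ} (A : Matrix (Fin n) (Fin n) ℝ) (z : ℂ) (hz : z ∈ spec A) :
    starRingEnd ℂ z ∈ spec A := by
  have h0 : A.charpoly.map (algebraMap ℝ ℂ) ≠ 0 := (A.charpoly_monic.map _).ne_zero
  rw [mem_spec, ← Polynomial.rootMultiplicity_pos h0] at hz ⊢
  exact hz.trans_eq (mult_conj A z).symm

theorem sum_mult {n : ℕ} (A : Matrix (Fin n) (Fin n) ℝ) : ∑ z ∈ spec A, mult A z = n := by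
  classical
  have h : (A.charpoly.map (algebraMap ℝ ℂ)).roots.card = n := by
    rw [IsAlgClosed.card_roots_eq_natDegree, Polynomial.natDegree_map,
      Matrix.charpoly_natDegree_eq_dim, Fintype.card_fin]
  have h2 := Multiset.toFinset_sum_count_eq (A.charpoly.map (algebraMap ℝ ℂ)).roots
  rw [h] at h2
  refine Eq.trans ?_ h2
  unfold spec mult
  exact Finset.sum_congr (by congr!) fun z _ => (Polynomial.count_roots _).symm

theorem zero_notMem_spec {n : ℕ} (M : GL (Fin n) ℝ) :
    (0 : ℂ) ∉ spec (M : Matrix (Fin n) (Fin n) ℝ) := by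
  rw [mem_spec, Polynomial.IsRoot, Polynomial.eval_map_algebraMap, ← map_zero (algebraMap ℝ ℂ),
    Polynomial.aeval_algebraMap_apply, Polynomial.coe_aeval_eq_eval]
  intro h
  have h1 : (M : Matrix (Fin n) (Fin n) ℝ).charpoly.eval 0 = 0 := by simpa using h
  have h2 := Matrix.det_eq_sign_charpoly_coeff (M : Matrix (Fin n) (Fin n) ℝ)
  rw [Polynomial.coeff_zero_eq_eval_zero, h1, mul_zero] at h2
  exact ((Matrix.isUnit_iff_isUnit_det _).1 M.isUnit).ne_zero h2

theorem sum_orderEmb (s : Finset ℝ) (f : ℝ → ℕ) :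
    ∑ i : Fin s.card, f (s.orderEmbOfFin rfl i) = ∑ x ∈ s, f x := by
  conv_rhs => rw [← Finset.image_orderEmbOfFin_univ s rfl]
  rw [Finset.sum_image fun _ _ _ _ h => (s.orderEmbOfFin rfl).injective h]

/-- The eigenvalues of a nonsingular matrix whose negative eigenvalues have even multiplicity
are all listed. -/
theorem order_eigData {n : ℕ} (M : GL (Fin n) ℝ)
    (hM : ∀ x : ℝ, x < 0 → Even (mult (M : Matrix (Fin n) (Fin n) ℝ) x)) :
    (eigData (M : Matrix (Fin n) (Fin n) ℝ)).order = n := by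
  classical
  set A := (M : Matrix (Fin n) (Fin n) ℝ) with hA
  have h1 : ∑ i, (eigData A).h i =
      ∑ z ∈ (spec A).filter (fun z => z.im = 0 ∧ 0 < z.re), mult A z := by
    refine (sum_orderEmb (posEig A) fun x => mult A x).trans ?_
    unfold posEig
    rw [Finset.sum_image]
    · refine Finset.sum_congr (by congr!) fun z hz => ?_
      congr 1
      apply Complex.ext <;> simp_all
    · intro z hz w hw h
      apply Complex.ext <;> simp_all
  have h3 : 2 * ∑ i, (eigData A).k i =
      ∑ z ∈ (spec A).filter (fun z => z.im = 0 ∧ z.re < 0), mult A z := by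
    rw [show ∑ i, (eigData A).k i = _ from
      sum_orderEmb (negEig A) fun x => mult A ((-x : ℝ) : ℂ) / 2]
    unfold negEig
    rw [Finset.sum_image, Finset.mul_sum]
    · refine Finset.sum_congr (by congr!) fun z hz => ?_
      have hz' : z.im = 0 ∧ z.re < 0 := by simp_all
      have e : (((- -z.re : ℝ)) : ℂ) = z := by
        apply Complex.ext <;> simp [hz'.1]
      rw [e]
      refine Nat.two_mul_div_two_of_even ?_
      rw [← e]
      exact hM _ (by simpa using hz'.2)
    · intro z hz w hw h
      apply Complex.ext <;> simp_all
  have h2 : ∑ l, ∑ t, (eigData A).m l t =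
      ∑ z ∈ (spec A).filter (fun z => 0 < z.im), mult A z := by
    have e1 : ∀ l, ∑ t, (eigData A).m l t =
        ∑ z ∈ (upperEig A).filter (fun z => z.arg = (upperArgs A).orderEmbOfFin rfl l),
          mult A z := by
      intro l
      refine (sum_orderEmb (upperNorms A ((upperArgs A).orderEmbOfFin rfl l)) fun x =>
        mult A ((x : ℂ) * Complex.exp (Complex.I *
          (((upperArgs A).orderEmbOfFin rfl l : ℝ) : ℂ)))).trans ?_
      have key : ∀ z : ℂ, z.arg = (upperArgs A).orderEmbOfFin rfl l →
          (‖z‖ : ℂ) * Complex.exp (Complex.I *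
            (((upperArgs A).orderEmbOfFin rfl l : ℝ) : ℂ)) = z := by
        intro z hz
        rw [← hz, mul_comm Complex.I]
        exact Complex.norm_mul_exp_arg_mul_I z
      unfold upperNorms
      rw [Finset.sum_image]
      · refine Finset.sum_congr (by congr!) fun z hz => ?_
        rw [key z (by simp_all)]
      · intro z hz w hw h
        have hz' := key z (by simp_all)
        have hw' := key w (by simp_all)
        rw [← hz', ← hw']
        simp only at h
        rw [h]
    rw [show ∑ l, ∑ t, (eigData A).m l t = _ from Finset.sum_congr rfl fun l _ => e1 l]
    refine (sum_orderEmb (upperArgs A) fun x =>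
      ∑ z ∈ (upperEig A).filter (fun z => z.arg = x), mult A z).trans ?_
    have e2 := Finset.sum_fiberwise_of_maps_to (s := upperEig A) (t := upperArgs A)
      (g := Complex.arg) (fun z hz => by unfold upperArgs; exact Finset.mem_image_of_mem _ hz)
      (fun z => mult A z)
    refine Eq.trans ?_ (e2.trans ?_)
    · exact Finset.sum_congr rfl fun x _ => Finset.sum_congr (by congr!) fun _ _ => rfl
    · exact Finset.sum_congr (by unfold upperEig; congr!) fun _ _ => rfl
  have h4 : ∑ z ∈ (spec A).filter (fun z => z.im < 0), mult A z =
      ∑ z ∈ (spec A).filter (fun z => 0 < z.im), mult A z := by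
    refine Finset.sum_bij' (fun z _ => starRingEnd ℂ z) (fun z _ => starRingEnd ℂ z)
      ?_ ?_ ?_ ?_ ?_
    · intro z hz
      simp only [Finset.mem_filter] at hz ⊢
      exact ⟨conj_mem_spec A z hz.1, by simpa using hz.2⟩
    · intro z hz
      simp only [Finset.mem_filter] at hz ⊢
      exact ⟨conj_mem_spec A z hz.1, by simpa using hz.2⟩
    · intro z _; simp
    · intro z _; simp
    · intro z _; exact (mult_conj A z).symm
  have hn := sum_mult A
  rw [EigData.order, h1, h2, h3]
  rw [two_mul]
  nth_rewrite 2 [← h4]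
  refine Eq.trans ?_ hn
  simp only [Finset.sum_filter, ← Finset.sum_add_distrib]
  refine Finset.sum_congr rfl fun z hz => ?_
  have hz0 : z ≠ 0 := fun h => zero_notMem_spec M (h ▸ hz)
  have hz1 : ¬ (z.im = 0 ∧ z.re = 0) := fun h => hz0 (Complex.ext h.2 h.1)
  rcases lt_trichotomy z.im 0 with h | h | h
  · simp [h, h.ne, h.not_gt]
  · rcases lt_trichotomy z.re 0 with h' | h' | h'
    · simp [h, h', h'.not_gt]
    · exact absurd ⟨h, h'⟩ hz1
    · simp [h, h', h'.not_gt]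
  · simp [h, h.ne', h.not_gt]

/-- The real Jordan standard form of `M`. -/
def rjs {n : ℕ} (M : GL (Fin n) ℝ)
    (hM : ∀ x : ℝ, x < 0 → Even (mult (M : Matrix (Fin n) (Fin n) ℝ) x)) :
    Matrix (Fin n) (Fin n) ℝ :=
  (eigData (M : Matrix (Fin n) (Fin n) ℝ)).jordan (order_eigData M hM)

/-- The real Jordan auxiliary form attached to `M` and to the indices `u`, `μ`. -/
def rja {n : ℕ} (M : GL (Fin n) ℝ)
    (hM : ∀ x : ℝ, x < 0 → Even (mult (M : Matrix (Fin n) (Fin n) ℝ) x))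
    (u : Fin (eigData (M : Matrix (Fin n) (Fin n) ℝ)).p → ℕ)
    (μ : ∀ l, Fin ((eigData (M : Matrix (Fin n) (Fin n) ℝ)).s l) → ℕ) :
    Matrix (Fin n) (Fin n) ℝ :=
  (eigData (M : Matrix (Fin n) (Fin n) ℝ)).aux (order_eigData M hM) u μ

/-- The set `𝒮ℛ(M)` of all real square roots of `M`. -/
def SR {n : ℕ} (M : Matrix (Fin n) (Fin n) ℝ) : Set (Matrix (Fin n) (Fin n) ℝ) :=
  {Y | Y ^ 2 = M}

/-- The real square roots of `M` whose eigenvalues have the multiplicities prescribed by the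
indices `u`, `μ`. -/
def stratum {n : ℕ} (M : Matrix (Fin n) (Fin n) ℝ) (u : Fin (eigData M).p → ℕ)
    (μ : ∀ l, Fin ((eigData M).s l) → ℕ) : Set (Matrix (Fin n) (Fin n) ℝ) :=
  {Y | Y ∈ SR M ∧
    (∀ i, mult Y ((√((eigData M).lam i) : ℝ) : ℂ) = u i ∧
      mult Y ((-√((eigData M).lam i) : ℝ) : ℂ) = (eigData M).h i - u i) ∧
    (∀ l t, ∀ ε : ℝ, ε = 1 ∨ ε = -1 →
      mult Y ((√((eigData M).rho l t) : ℝ) *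
        Complex.exp (Complex.I * ((ε * ((eigData M).theta l / 2) : ℝ) : ℂ))) = μ l t ∧
      mult Y ((√((eigData M).rho l t) : ℝ) *
        Complex.exp (Complex.I * ((ε * ((eigData M).theta l / 2 - Real.pi) : ℝ) : ℂ))) =
          (eigData M).m l t - μ l t) ∧
    (∀ i, ∀ ε : ℝ, ε = 1 ∨ ε = -1 →
      mult Y (((ε * √((eigData M).zeta i) : ℝ) : ℂ) * Complex.I) = (eigData M).k i)}

/-- The group `𝒞_B` of the nonsingular matrices commuting with `B`. -/
def comm {n : ℕ} (B : Matrix (Fin n) (Fin n) ℝ) : Subgroup (GL (Fin n) ℝ) where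
  carrier := {X | ⁅B, (X : Matrix (Fin n) (Fin n) ℝ)⁆ = 0}
  one_mem' := by
    simp only [Set.mem_ofPred_eq, ← commute_iff_lie_eq]
    simp
  mul_mem' := by
    intro X Y hX hY
    simp only [Set.mem_ofPred_eq, ← commute_iff_lie_eq] at *
    simpa using hX.mul_right hY
  inv_mem' := by
    intro X hX
    simp only [Set.mem_ofPred_eq, ← commute_iff_lie_eq] at *
    exact hX.units_inv_right

/-- The conjugation map by `C`. -/
def conj {n : ℕ} (C : GL (Fin n) ℝ) (A : Matrix (Fin n) (Fin n) ℝ) :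
    Matrix (Fin n) (Fin n) ℝ :=
  (C : Matrix (Fin n) (Fin n) ℝ) * A * ((C⁻¹ : GL (Fin n) ℝ) : Matrix (Fin n) (Fin n) ℝ)

/-- The smooth structure on the subset `S` of `GL_n`, with its subspace topology, makes it an
embedded submanifold: `S` is a smooth manifold and the inclusion is a smooth embedding. -/
def IsEmbeddedSubmanifold {n d : ℕ} (S : Set (GL (Fin n) ℝ))
    [ChartedSpace (EuclideanSpace ℝ (Fin d)) S] : Prop :=
  IsManifold (𝓡 d) ∞ S ∧
    Manifold.IsSmoothEmbedding (𝓡 d) 𝓘(ℝ, Matrix (Fin n) (Fin n) ℝ) ∞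
      (Subtype.val : S → GL (Fin n) ℝ)

/-- The smooth structure on the subgroup `G` of `GL_n`, with its subspace topology, makes it an
embedded Lie subgroup. -/
def IsLieSubgroup {n a : ℕ} (G : Subgroup (GL (Fin n) ℝ))
    [ChartedSpace (EuclideanSpace ℝ (Fin a)) G] : Prop :=
  LieGroup (𝓡 a) ∞ G ∧
    Manifold.IsSmoothEmbedding (𝓡 a) 𝓘(ℝ, Matrix (Fin n) (Fin n) ℝ) ∞
      (Subtype.val : G → GL (Fin n) ℝ)

/-- The smooth structure on the set `G ⧸ H` of left cosets, with its quotient topology, is the one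
of the homogeneous space: `G ⧸ H` is a smooth manifold and the projection is a smooth
submersion. (There is only one such structure.) -/
def IsHomogeneousSpace {a b : ℕ} {G : Type*} [TopologicalSpace G] [Group G]
    [ChartedSpace (EuclideanSpace ℝ (Fin a)) G] (H : Subgroup G)
    [ChartedSpace (EuclideanSpace ℝ (Fin b)) (G ⧸ H)] : Prop :=
  IsManifold (𝓡 b) ∞ (G ⧸ H) ∧
    Manifold.IsSubmersion (𝓡 a) (𝓡 b) ∞ (QuotientGroup.mk : G → G ⧸ H)

end SqrtStrata

end

/-! Algebra. The auxiliary form squares to the Jordan form, so its conjugate by `C` is one square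
root of `M`. Every square root `Y` of `M` is diagonalizable over `ℂ`: if `p` is the minimal
polynomial of `M`, then `p` is separable with `p 0 ≠ 0`, hence `p (X ^ 2)` is separable, and it
kills `Y` (`Matrix.isSemisimple_of_sq`). The prescribed multiplicities add up to `n`, so they amount
to prescribing the characteristic polynomial (`SqrtStrata.mem_stratum_iff`). Two square roots with
the same characteristic polynomial are therefore similar over `ℂ`, hence over `ℝ`, and any
conjugating matrix commutes with their common square `M` (`SqrtStrata.exists_conj_of_sq_eq`). Thus
the stratum is one orbit; it is closed, since `Y * Y = M` and the equality of characteristic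
polynomials are closed conditions.

Geometry. Let `A` be a unit of a finite-dimensional real algebra. Conjugation by `A` is an
involution of the centralizer of `A ^ 2`, which splits into elements anticommuting and elements
commuting with `A`. If `Z ^ 2 = A ^ 2` and `Z + A` is invertible, then `W = (Z - A) (Z + A)⁻¹`
anticommutes with `A` and `1 + W` conjugates `A` into `Z` (`cayley_root`, with converse
`cayley_conj`). So the Cayley transform, which is a chart of the whole group of units, maps the
orbit onto an open part of a linear subspace: the orbit is embedded. It also gives local sections `Z
↦ 1 + W` of the orbit map, so the orbit is homeomorphic to the coset space, to which its smooth
structure is transported. In the coordinates `(1 + W) k ↦ (W, k)` of the centralizer of `A ^ 2`,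
with `k` commuting with `A`, the projection to the cosets is `(W, k) ↦ W`, a submersion. These
statements are collected in `exists_orbit_structures`. -/

/-! ### Smooth structures whose charts extend to an ambient normed space -/

/-- A cover of `X` by charts with values in `E`, smoothly compatible with a map `incl` from `X` to
an ambient normed space: inverse charts are smooth as maps to `R`, and every chart is locally the
restriction of a smooth map on `R`. -/
structure EmbeddedAtlas (X R E ι : Type*) [TopologicalSpace X] [NormedAddCommGroup R]
    [NormedSpace ℝ R] [NormedAddCommGroup E] [NormedSpace ℝ E] where
  incl : X → R
  chart : ι → OpenPartialHomeomorph X E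
  index : X → ι
  mem_source : ∀ x, x ∈ (chart (index x)).source
  ext : ι → R → E
  contDiffAt_ext : ∀ p, ∀ x ∈ (chart p).source, ContDiffAt ℝ ∞ (ext p) (incl x)
  chart_eq : ∀ p, ∀ x ∈ (chart p).source, chart p x = ext p (incl x)
  contDiffOn_symm : ∀ p, ContDiffOn ℝ ∞ (incl ∘ (chart p).symm) (chart p).target

namespace EmbeddedAtlas

variable {X X' R E ι : Type*} [TopologicalSpace X] [TopologicalSpace X'] [NormedAddCommGroup R]
  [NormedSpace ℝ R] [NormedAddCommGroup E] [NormedSpace ℝ E] (A : EmbeddedAtlas X R E ι)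

/-- The charted space given by an embedded atlas. -/
abbrev chartedSpace : ChartedSpace E X where
  atlas := Set.range A.chart
  chartAt x := A.chart (A.index x)
  mem_chart_source := A.mem_source
  chart_mem_atlas _ := Set.mem_range_self _

/-- A transition map is `ext q` after the inverse chart of `p` read in the ambient space, and both
are smooth. -/
theorem isManifold : @IsManifold ℝ _ E _ _ E _ 𝓘(ℝ, E) ∞ X _ A.chartedSpace := by
  let := A.chartedSpace
  apply isManifold_of_contDiffOn
  rintro _ _ ⟨p, rfl⟩ ⟨q, rfl⟩
  simp only [modelWithCornersSelf_coe, modelWithCornersSelf_coe_symm, Set.range_id,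
    Set.inter_univ, Set.preimage_id, Function.comp_id, Function.id_comp]
  intro w hw
  have hw1 : w ∈ (A.chart p).target := by
    simpa using (by simpa using hw : _ ∧ _).1
  have hw2 : (A.chart p).symm w ∈ (A.chart q).source := by
    simpa using (by simpa using hw : _ ∧ _).2
  have h1 : ContDiffAt ℝ ∞ (A.incl ∘ (A.chart p).symm) w :=
    (A.contDiffOn_symm p).contDiffAt ((A.chart p).open_target.mem_nhds hw1)
  have h2 : ContDiffAt ℝ ∞ (A.ext q ∘ (A.incl ∘ (A.chart p).symm)) w :=
    ContDiffAt.comp w (A.contDiffAt_ext q _ hw2) h1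
  refine (h2.contDiffWithinAt.congr_of_mem (s := ((A.chart p).symm.trans (A.chart q)).source)
    (fun y hy => ?_) hw)
  have hy2 : (A.chart p).symm y ∈ (A.chart q).source := by
    simpa using (by simpa using hy : _ ∧ _).2
  exact A.chart_eq q _ hy2

theorem chart_mem_maximalAtlas (p : ι) :
    letI := A.chartedSpace
    A.chart p ∈ IsManifold.maximalAtlas 𝓘(ℝ, E) ∞ X := by
  let := A.chartedSpace
  have := A.isManifold
  exact IsManifold.subset_maximalAtlas (Set.mem_range_self p)

theorem contMDiff_incl :
    letI := A.chartedSpace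
    ContMDiff 𝓘(ℝ, E) 𝓘(ℝ, R) ∞ A.incl := by
  let := A.chartedSpace
  have := A.isManifold
  intro x
  set c := A.chart (A.index x)
  have h1 : ContMDiffAt 𝓘(ℝ, E) 𝓘(ℝ, E) ∞ c x :=
    contMDiffAt_of_mem_maximalAtlas (A.chart_mem_maximalAtlas _) (A.mem_source x)
  have h2 : ContMDiffAt 𝓘(ℝ, E) 𝓘(ℝ, R) ∞ (A.incl ∘ c.symm) (c x) :=
    ((A.contDiffOn_symm _).contDiffAt
      (c.open_target.mem_nhds (c.map_source (A.mem_source x)))).contMDiffAt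
  refine (h2.comp x h1).congr_of_eventuallyEq ?_
  filter_upwards [c.open_source.mem_nhds (A.mem_source x)] with y hy
  simp [c.left_inv hy]

variable {E' H N : Type*} [NormedAddCommGroup E'] [NormedSpace ℝ E'] [TopologicalSpace H]
  {I : ModelWithCorners ℝ E' H} [TopologicalSpace N] [ChartedSpace H N]

/-- In a chart, `g` is `ext` applied to `incl ∘ g`. Continuity is a separate hypothesis because it
keeps `g` inside the chart domain: `incl` is not assumed to be a topological embedding. -/
theorem contMDiffOn_of_comp {g : N → X} {s : Set N} (hg : ContinuousOn g s)
    (hs : ContMDiffOn I 𝓘(ℝ, R) ∞ (A.incl ∘ g) s) :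
    letI := A.chartedSpace
    ContMDiffOn I 𝓘(ℝ, E) ∞ g s := by
  let := A.chartedSpace
  intro x hx
  rw [contMDiffWithinAt_iff_target]
  refine ⟨hg x hx, ?_⟩
  set c := A.chart (A.index (g x))
  have hc : (extChartAt 𝓘(ℝ, E) (g x) : X → E) = c := by
    ext y; simp [extChartAt, c]; rfl
  rw [hc]
  have h1 : ContMDiffAt 𝓘(ℝ, R) 𝓘(ℝ, E) ∞ (A.ext (A.index (g x))) (A.incl (g x)) :=
    (A.contDiffAt_ext _ _ (A.mem_source (g x))).contMDiffAt
  refine (h1.comp_contMDiffWithinAt x (hs x hx)).congr_of_eventuallyEq ?_ ?_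
  · filter_upwards [hg x hx (c.open_source.mem_nhds (A.mem_source (g x)))] with y hy
    exact A.chart_eq _ _ hy
  · exact A.chart_eq _ _ (A.mem_source _)

theorem contMDiff_of_comp {g : N → X} (hg : Continuous g)
    (hs : ContMDiff I 𝓘(ℝ, R) ∞ (A.incl ∘ g)) :
    letI := A.chartedSpace
    ContMDiff I 𝓘(ℝ, E) ∞ g :=
  let := A.chartedSpace
  contMDiffOn_univ.1 (A.contMDiffOn_of_comp hg.continuousOn hs.contMDiffOn)

/-- A chart is in the maximal atlas if its inverse is smooth as a map to the ambient space and it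
is the restriction of a smooth map on the ambient space. -/
theorem mem_maximalAtlas (c : OpenPartialHomeomorph X E) (F : R → E)
    (hF : ∀ x ∈ c.source, ContDiffAt ℝ ∞ F (A.incl x)) (hc : ∀ x ∈ c.source, c x = F (A.incl x))
    (hsymm : ContDiffOn ℝ ∞ (A.incl ∘ c.symm) c.target) :
    letI := A.chartedSpace
    c ∈ IsManifold.maximalAtlas 𝓘(ℝ, E) ∞ X := by
  let := A.chartedSpace
  have := A.isManifold
  refine c.mem_maximalAtlas_of_contMDiffOn ?_ ?_
  · refine ContMDiffOn.congr (f := F ∘ A.incl) (fun x hx => ?_) hc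
    exact ((hF x hx).contMDiffAt.comp x (A.contMDiff_incl x)).contMDiffWithinAt
  · exact A.contMDiffOn_of_comp c.continuousOn_symm hsymm.contMDiffOn

/-- Transport of an embedded atlas along a homeomorphism. -/
def pullback (h : X' ≃ₜ X) : EmbeddedAtlas X' R E ι where
  incl := A.incl ∘ h
  chart p := h.toOpenPartialHomeomorph.trans (A.chart p)
  index := A.index ∘ h
  mem_source x := by simpa using A.mem_source (h x)
  ext := A.ext
  contDiffAt_ext p x hx := A.contDiffAt_ext p _ (by simpa using hx)
  chart_eq p x hx := A.chart_eq p _ (by simpa using hx)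
  contDiffOn_symm p := by
    have : (A.incl ∘ h) ∘ (h.toOpenPartialHomeomorph.trans (A.chart p)).symm =
        A.incl ∘ (A.chart p).symm := by ext; simp
    rw [this]
    simpa using A.contDiffOn_symm p

/-- The transported smooth structure is diffeomorphic to the given one. -/
def diffeomorph (h : X' ≃ₜ X) :
    letI := A.chartedSpace
    letI := (A.pullback h).chartedSpace
    Diffeomorph 𝓘(ℝ, E) 𝓘(ℝ, E) X X' ∞ :=
  letI := A.chartedSpace
  letI := (A.pullback h).chartedSpace
  { h.symm.toEquiv with
    contMDiff_toFun := (A.pullback h).contMDiff_of_comp h.symm.continuous (by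
      have : (A.pullback h).incl ∘ h.symm = A.incl := by ext; simp [pullback]
      exact this ▸ A.contMDiff_incl)
    contMDiff_invFun := A.contMDiff_of_comp h.continuous (A.pullback h).contMDiff_incl }

end EmbeddedAtlas

/-! ### Units and the Cayley transform -/

theorem Ring.inverse_eq_of_mul_eq_one {R : Type*} [MonoidWithZero R] {x y : R} (h : x * y = 1)
    (h' : y * x = 1) : Ring.inverse x = y :=
  Ring.inverse_unit (⟨x, y, h, h'⟩ : Rˣ)

open Classical in
/-- The unit with value `x`, or `1` if `x` is not a unit. -/
noncomputable def Units.ofElem {R : Type*} [Monoid R] (x : R) : Rˣ :=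
  if h : IsUnit x then h.unit else 1

theorem Units.val_ofElem {R : Type*} [Monoid R] {x : R} (h : IsUnit x) :
    (Units.ofElem x : R) = x := by
  simp [Units.ofElem, h]

/-- The default value `1` lies in every subgroup, so inverse charts built from `Units.ofElem` take
values in the right subgroup even outside their targets. -/
theorem Units.ofElem_prop {R : Type*} [Monoid R] (p : Rˣ → Prop) (h1 : p 1) {x : R}
    (h : ∀ u : Rˣ, (u : R) = x → p u) : p (Units.ofElem x) := by
  unfold Units.ofElem
  split_ifs with hx
  · exact h _ hx.unit_spec
  · exact h1

section Cayley

variable {R : Type*} [NormedRing R] [NormedAlgebra ℝ R]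

/-- The Cayley type transform `Z ↦ 1 - 2 A (Z + A)⁻¹ = (Z - A) (Z + A)⁻¹`. -/
noncomputable def cayley (A : Rˣ) (Z : R) : R :=
  1 - (2 : ℝ) • ((A : R) * Ring.inverse (Z + A))

/-- The inverse `W ↦ 2 (1 - W)⁻¹ A - A` of the Cayley type transform. -/
noncomputable def cayleyInv (A : Rˣ) (W : R) : R :=
  (2 : ℝ) • (Ring.inverse (1 - W) * A) - A

theorem isUnit_one_sub_cayley (A : Rˣ) {Z : R} (hZ : IsUnit (Z + A)) :
    IsUnit (1 - cayley A Z) := by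
  have : 1 - cayley A Z = (2 : ℝ) • ((A : R) * Ring.inverse (Z + A)) := by
    simp [cayley]
  rw [this]
  exact ((A.isUnit.mul hZ.ringInverse).smul (Units.mk0 (2 : ℝ) two_ne_zero))

theorem cayleyInv_cayley (A : Rˣ) {Z : R} (hZ : IsUnit (Z + A)) :
    cayleyInv A (cayley A Z) = Z := by
  obtain ⟨U, hU⟩ := hZ
  have h : Ring.inverse (1 - cayley A Z) = (2⁻¹ : ℝ) • ((U : R) * (A⁻¹ : Rˣ)) := by
    apply Ring.inverse_eq_of_mul_eq_one <;>
    simp [cayley, ← hU, mul_assoc]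
  rw [cayleyInv, h]
  simp [mul_assoc, hU]

theorem cayleyInv_add (A : Rˣ) (W : R) :
    cayleyInv A W + A = (2 : ℝ) • (Ring.inverse (1 - W) * A) := by
  simp [cayleyInv]

theorem isUnit_cayleyInv_add (A : Rˣ) {W : R} (hW : IsUnit (1 - W)) :
    IsUnit (cayleyInv A W + A) := by
  rw [cayleyInv_add]
  exact ((hW.ringInverse.mul A.isUnit).smul (Units.mk0 (2 : ℝ) two_ne_zero))

theorem cayley_cayleyInv (A : Rˣ) {W : R} (hW : IsUnit (1 - W)) :
    cayley A (cayleyInv A W) = W := by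
  obtain ⟨U, hU⟩ := hW
  have h : Ring.inverse (cayleyInv A W + A) = (2⁻¹ : ℝ) • ((A⁻¹ : Rˣ) * (U : R)) := by
    rw [cayleyInv_add]
    apply Ring.inverse_eq_of_mul_eq_one <;>
    simp [← hU, mul_assoc]
  rw [cayley, h]
  simp [hU]

/-- If `Z ^ 2 = A ^ 2`, then the Cayley transform `W` of `Z` anticommutes with `A`, and `1 + W`
conjugates `A` into `Z`. -/
theorem cayley_root {A Z : Rˣ} (h : Z ^ 2 = A ^ 2) (hZ : IsUnit ((Z : R) + A)) :
    A * cayley A Z = -(cayley A Z * A) ∧ (1 + cayley A Z) * A = Z * (1 + cayley A (Z : R)) ∧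
      IsUnit (1 + cayley A (Z : R)) := by
  have h2 : (Z : R) * Z = A * A := by
    have := congrArg (Units.val) h
    simpa [pow_two] using this
  obtain ⟨U, hU⟩ := hZ
  have e : cayley A (Z : R) = 1 - (2 : ℝ) • ((A : R) * (U⁻¹ : Rˣ)) := by
    simp [cayley, ← hU]
  have c1 : (Z : R) * (U⁻¹ : Rˣ) + A * (U⁻¹ : Rˣ) = 1 := by
    rw [← add_mul, ← hU, Units.mul_inv]
  -- With `U = Z + A`, the equality `Z ^ 2 = A ^ 2` gives `U A = Z U` and `U Z = A U`: conjugation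
  -- by `U` exchanges `A` and `Z`.
  have c2 : (A : R) * (U⁻¹ : Rˣ) = (U⁻¹ : Rˣ) * Z := by
    rw [Units.eq_inv_mul_iff_mul_eq, ← mul_assoc, Units.mul_inv_eq_iff_eq_mul, hU]
    simp only [mul_add, add_mul, h2]
    abel
  have c3 : (Z : R) * (U⁻¹ : Rˣ) = (U⁻¹ : Rˣ) * A := by
    rw [Units.eq_inv_mul_iff_mul_eq, ← mul_assoc, Units.mul_inv_eq_iff_eq_mul, hU]
    simp only [mul_add, add_mul, h2]
    abel
  have e2 : 1 + cayley A (Z : R) = (2 : ℝ) • ((Z : R) * (U⁻¹ : Rˣ)) := by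
    rw [e, ← c1, two_smul, two_smul]
    abel
  refine ⟨?_, ?_, ?_⟩
  · rw [e]
    have : (A : R) * (A * (U⁻¹ : Rˣ)) + A * (U⁻¹ : Rˣ) * A = A := by
      rw [mul_assoc, ← c3, ← mul_add, add_comm, c1, mul_one]
    simp only [mul_sub, sub_mul, mul_one, one_mul, mul_smul_comm, smul_mul_assoc]
    rw [eq_sub_of_add_eq this]
    module
  · rw [e2, smul_mul_assoc, mul_smul_comm, mul_assoc, ← c3]
  · rw [e2]
    exact ((Z.isUnit.mul U⁻¹.isUnit).smul (Units.mk0 (2 : ℝ) two_ne_zero))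

/-- The Cayley transform of `U A U⁻¹` with `U = 1 + W`, where `W` anticommutes with `A`. -/
theorem cayley_conj {A U : Rˣ} {W : R} (hA : A * W = -(W * A)) (hU : (U : R) = 1 + W) :
    IsUnit ((U * A * U⁻¹ : Rˣ) + A : R) ∧ cayley A ((U * A * U⁻¹ : Rˣ) : R) = W := by
  have h1 : ((U * A * U⁻¹ : Rˣ) + A : R) = (2 : ℝ) • ((A : R) * (U⁻¹ : Rˣ)) := by
    -- Anticommutation cancels the terms in `W`, so `U A + A U = 2 A`.
    have : (U : R) * A + A * U = (2 : ℝ) • (A : R) := by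
      rw [hU, two_smul, mul_add, add_mul, hA]
      simp only [mul_one, one_mul]
      abel
    rw [← smul_mul_assoc, ← this, add_mul]
    simp [mul_assoc]
  refine ⟨?_, ?_⟩
  · rw [h1]
    exact ((A.isUnit.mul U⁻¹.isUnit).smul (Units.mk0 (2 : ℝ) two_ne_zero))
  · have h : Ring.inverse ((U * A * U⁻¹ : Rˣ) + A : R) = (2⁻¹ : ℝ) • ((U : R) * (A⁻¹ : Rˣ)) := by
      rw [h1]
      apply Ring.inverse_eq_of_mul_eq_one <;> simp [mul_assoc]
    rw [cayley, h, hU]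
    simp only [mul_smul_comm, smul_smul, add_mul, one_mul, mul_add, ← mul_assoc, hA, neg_mul]
    simp

variable [CompleteSpace R]

theorem contDiffAt_cayley (A : Rˣ) {Z : R} (hZ : IsUnit (Z + A)) :
    ContDiffAt ℝ ∞ (cayley A) Z := by
  obtain ⟨U, hU⟩ := hZ
  have h : ContDiffAt ℝ ∞ (fun Z : R => Ring.inverse (Z + A)) Z :=
    ContDiffAt.comp Z (g := Ring.inverse) (f := fun Z : R => Z + A)
      (hU ▸ contDiffAt_ringInverse ℝ U) (by fun_prop)
  unfold cayley
  fun_prop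

theorem contDiffAt_cayleyInv (A : Rˣ) {W : R} (hW : IsUnit (1 - W)) :
    ContDiffAt ℝ ∞ (cayleyInv A) W := by
  obtain ⟨U, hU⟩ := hW
  have h : ContDiffAt ℝ ∞ (fun W : R => Ring.inverse (1 - W)) W :=
    ContDiffAt.comp W (g := Ring.inverse) (f := fun W : R => 1 - W)
      (hU ▸ contDiffAt_ringInverse ℝ U) (by fun_prop)
  unfold cayleyInv
  fun_prop

/-- The Cayley transform of `P⁻¹ Y P`, as a local coordinate on the algebra `R`. -/
noncomputable def cayleyChart (A P : Rˣ) : OpenPartialHomeomorph R R where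
  toFun Y := cayley A ((P⁻¹ : Rˣ) * Y * P)
  invFun W := P * cayleyInv A W * (P⁻¹ : Rˣ)
  source := {Y | IsUnit ((P⁻¹ : Rˣ) * Y * P + A : R)}
  target := {W | IsUnit (1 - W)}
  map_source' Y hY := isUnit_one_sub_cayley A hY
  map_target' W hW := by
    simpa [mul_assoc] using isUnit_cayleyInv_add A hW
  left_inv' Y hY := by
    rw [cayleyInv_cayley A hY]
    simp [mul_assoc]
  right_inv' W hW := by
    simp [mul_assoc, cayley_cayleyInv A hW]
  open_source := Units.isOpen.preimage (by fun_prop)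
  open_target := Units.isOpen.preimage (by fun_prop)
  continuousOn_toFun Y hY := by
    have h := (contDiffAt_cayley A hY).continuousAt
    exact (ContinuousAt.comp (g := cayley A) (f := fun Y : R => (P⁻¹ : Rˣ) * Y * P) h
      (by fun_prop)).continuousWithinAt
  continuousOn_invFun W hW := by
    have h := (contDiffAt_cayleyInv A hW).continuousAt
    exact ContinuousAt.continuousWithinAt (by fun_prop)

/-- The Cayley transform of `P⁻¹ Y P`, as a chart on the group of units of `R`. -/
noncomputable def cayleyUnitsChart (A P : Rˣ) : OpenPartialHomeomorph Rˣ R :=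
  (chartAt R (1 : Rˣ)).trans (cayleyChart A P)

theorem cayleyUnitsChart_mem_maximalAtlas (A P : Rˣ) :
    cayleyUnitsChart A P ∈ IsManifold.maximalAtlas 𝓘(ℝ, R) ∞ Rˣ := by
  -- The chart at `1` is the inclusion of the open set of units into `R`; the Cayley chart is then a
  -- diffeomorphism between open subsets of `R`.
  have h1 : chartAt R (1 : Rˣ) ∈ IsManifold.maximalAtlas 𝓘(ℝ, R) ∞ Rˣ :=
    IsManifold.chart_mem_maximalAtlas 1
  have hc : ContDiffOn ℝ ∞ (cayleyChart A P) (cayleyChart A P).source := fun Y hY =>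
    (ContDiffAt.comp Y (g := cayley A) (f := fun Y : R => (P⁻¹ : Rˣ) * Y * P)
      (contDiffAt_cayley A hY) (by fun_prop)).contDiffWithinAt
  have hc' : ContDiffOn ℝ ∞ (cayleyChart A P).symm (cayleyChart A P).target := fun W hW =>
    (ContDiffAt.mul (ContDiffAt.mul contDiffAt_const (contDiffAt_cayleyInv A hW))
      contDiffAt_const).contDiffWithinAt
  refine OpenPartialHomeomorph.mem_maximalAtlas_of_contMDiffOn _ ?_ ?_
  · exact hc.contMDiffOn.comp ((contMDiffOn_of_mem_maximalAtlas h1).mono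
      (fun _ _ => Set.mem_univ _)) (fun x hx => by
        rw [cayleyUnitsChart, OpenPartialHomeomorph.trans_source] at hx
        exact hx.2)
  · exact (contMDiffOn_symm_of_mem_maximalAtlas h1).comp (hc'.contMDiffOn.mono
      (fun x hx => by
        rw [cayleyUnitsChart, OpenPartialHomeomorph.trans_target] at hx
        exact hx.1)) (fun x hx => by
        rw [cayleyUnitsChart, OpenPartialHomeomorph.trans_target] at hx
        exact hx.2)

end Cayley

theorem Units.continuousOn_ofElem {R : Type*} [NormedRing R] [CompleteSpace R] :
    ContinuousOn (Units.ofElem : R → Rˣ) {x | IsUnit x} := by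
  rw [Units.isOpenEmbedding_val.isInducing.continuousOn_iff]
  exact continuousOn_id.congr fun x hx => Units.val_ofElem hx

/-! ### The splitting of the centralizer of `A ^ 2` -/

/-- Linear coordinates on the centralizer of `A ^ 2`: the space `E` parametrizes the elements
anticommuting with `A`, and the space `F` those commuting with `A`. -/
structure AntiSplitting {R : Type*} [NormedRing R] [NormedAlgebra ℝ R] (A : Rˣ) (E F : Type*)
    [NormedAddCommGroup E] [NormedSpace ℝ E] [NormedAddCommGroup F] [NormedSpace ℝ F] where
  inM : E →L[ℝ] R
  inP : F →L[ℝ] R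
  prM : R →L[ℝ] E
  prP : R →L[ℝ] F
  prM_inM : ∀ w, prM (inM w) = w
  prM_inP : ∀ k, prM (inP k) = 0
  prP_inM : ∀ w, prP (inM w) = 0
  prP_inP : ∀ k, prP (inP k) = k
  anti : ∀ w, A * inM w = -(inM w * A)
  comm : ∀ k, A * inP k = inP k * A
  decomp : ∀ X : R, (A * A : R) * X = X * (A * A) → inM (prM X) + inP (prP X) = X

namespace AntiSplitting

section Group

variable {R : Type*} [Ring R] {A : Rˣ}

/-- The centralizer of `A ^ 2` in the group of units. -/
abbrev grp (A : Rˣ) : Subgroup Rˣ := Subgroup.centralizer {A ^ 2}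

theorem mem_grp {X : Rˣ} : X ∈ grp A ↔ (A * A : R) * X = X * (A * A) := by
  rw [Subgroup.mem_centralizer_singleton_iff, eq_comm, Units.ext_iff]
  simp [pow_two]

/-- The orbit of `A` under conjugation by the elements of `C * grp A`. -/
def orbit (A C : Rˣ) : Set Rˣ := {Y | ∃ X ∈ grp A, Y = C * X * A * X⁻¹ * C⁻¹}

theorem mem_orbit {C X : Rˣ} (hX : X ∈ grp A) : C * X * A * (C * X)⁻¹ ∈ orbit A C :=
  ⟨X, hX, by group⟩

/-- Translating a point of the orbit back by `C X` gives a square root of `A ^ 2`, to which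
`cayley_root` applies. -/
theorem orbit_sq {C X Y : Rˣ} (hX : X ∈ grp A) (hY : Y ∈ orbit A C) :
    ((C * X)⁻¹ * Y * (C * X)) ^ 2 = A ^ 2 := by
  obtain ⟨X', hX', rfl⟩ := hY
  have h : X⁻¹ * X' ∈ grp A := mul_mem (inv_mem hX) hX'
  rw [Subgroup.mem_centralizer_singleton_iff] at h
  calc _ = X⁻¹ * X' * A ^ 2 * (X⁻¹ * X')⁻¹ := by rw [pow_two, pow_two]; group
    _ = _ := by rw [h]; group

theorem centralizer_le (A : Rˣ) : Subgroup.centralizer {A} ≤ grp A := fun X hX => by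
  rw [Subgroup.mem_centralizer_singleton_iff] at hX ⊢
  exact ((show Commute X A from hX).pow_right 2).eq

end Group

variable {R : Type*} [NormedRing R] [NormedAlgebra ℝ R] {A : Rˣ} {E F : Type*}
  [NormedAddCommGroup E] [NormedSpace ℝ E] [NormedAddCommGroup F] [NormedSpace ℝ F]

/-- On the centralizer of `A ^ 2`, conjugation by `A` is an involution; its eigenspaces for `-1` and
`1` are the anticommuting and the commuting elements. -/
theorem exists_euclidean [FiniteDimensional ℝ R] (A : Rˣ) :
    ∃ d c : ℕ, Nonempty
      (AntiSplitting A (EuclideanSpace ℝ (Fin d)) (EuclideanSpace ℝ (Fin c))) := by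
  let VM : Submodule ℝ R :=
    LinearMap.ker (LinearMap.mulLeft ℝ (A : R) + LinearMap.mulRight ℝ (A : R))
  let VP : Submodule ℝ R :=
    LinearMap.ker (LinearMap.mulLeft ℝ (A : R) - LinearMap.mulRight ℝ (A : R))
  have hVM : ∀ {X : R}, X ∈ VM ↔ A * X = -(X * A) := by
    intro X; simp [VM, eq_neg_iff_add_eq_zero]
  have hVP : ∀ {X : R}, X ∈ VP ↔ A * X = X * A := by
    intro X; simp [VP, sub_eq_zero]
  let eM : EuclideanSpace ℝ (Fin (Module.finrank ℝ VM)) ≃ₗ[ℝ] VM :=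
    LinearEquiv.ofFinrankEq _ _ (by simp)
  let eP : EuclideanSpace ℝ (Fin (Module.finrank ℝ VP)) ≃ₗ[ℝ] VP :=
    LinearEquiv.ofFinrankEq _ _ (by simp)
  let iM := VM.subtype ∘ₗ eM.toLinearMap
  let iP := VP.subtype ∘ₗ eP.toLinearMap
  have hM : ∀ w, A * iM w = -(iM w * A) := fun w => hVM.1 (eM w).2
  have hP : ∀ w, A * iP w = iP w * A := fun w => hVP.1 (eP w).2
  have hinj : LinearMap.ker (iM.coprod iP) = ⊥ := by
    rw [LinearMap.ker_eq_bot']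
    rintro ⟨w, k⟩ h
    have h1 : iM w + iP k = 0 := by simpa using h
    -- The anticommutator with `A` kills the first summand and doubles the second, so the two
    -- subspaces are independent.
    have h2 : (A : R) * (iM w + iP k) + (iM w + iP k) * A = (2 : ℝ) • (A * iP k) := by
      rw [mul_add, add_mul, hM, hP]; module
    have h3 : iP k = 0 := by
      rw [h1] at h2
      simpa using h2.symm
    have h4 : iM w = 0 := by simpa [h3] using h1
    simp only [iM, iP, LinearMap.comp_apply, LinearEquiv.coe_coe, Submodule.subtype_apply,
      ZeroMemClass.coe_eq_zero, LinearEquiv.map_eq_zero_iff] at h3 h4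
    rw [h3, h4]; rfl
  -- The projections come from any linear left inverse. Being defined on all of `R`, they provide
  -- the ambient extensions of the charts; only their values on the centralizer of `A ^ 2` matter.
  obtain ⟨g, hg⟩ := LinearMap.exists_leftInverse_of_injective _ hinj
  have hg' : ∀ w k, g (iM w + iP k) = (w, k) := fun w k => by
    simpa using LinearMap.congr_fun hg (w, k)
  have hgM : ∀ w, g (iM w) = (w, 0) := fun w => by simpa using hg' w 0
  have hgP : ∀ k, g (iP k) = (0, k) := fun k => by simpa using hg' 0 k
  refine ⟨_, _, ⟨{
    inM := LinearMap.toContinuousLinearMap iM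
    inP := LinearMap.toContinuousLinearMap iP
    prM := LinearMap.toContinuousLinearMap (LinearMap.fst ℝ _ _ ∘ₗ g)
    prP := LinearMap.toContinuousLinearMap (LinearMap.snd ℝ _ _ ∘ₗ g)
    prM_inM := fun w => by simp [hgM]
    prM_inP := fun w => by simp [hgP]
    prP_inM := fun w => by simp [hgM]
    prP_inP := fun w => by simp [hgP]
    anti := hM
    comm := hP
    decomp := fun X hX => ?_ }⟩⟩
  -- `T = A X A⁻¹` is the image of `X` under the involution, and `X` is the sum of `(X - T) / 2` and
  -- `(X + T) / 2`.
  set T : R := (A : R) * X * (A⁻¹ : Rˣ) with hT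
  have hTA : T * A = A * X := by simp [hT, mul_assoc]
  have hAT : A * T = X * A := by
    rw [hT, ← mul_assoc, ← mul_assoc, hX]; simp [mul_assoc]
  have m1 : (2⁻¹ : ℝ) • (X - T) ∈ VM := by
    rw [hVM, mul_smul_comm, smul_mul_assoc, mul_sub, sub_mul, hTA, hAT]; module
  have m2 : (2⁻¹ : ℝ) • (X + T) ∈ VP := by
    rw [hVP, mul_smul_comm, smul_mul_assoc, mul_add, add_mul, hTA, hAT]; module
  have e1 : iM (eM.symm ⟨_, m1⟩) = (2⁻¹ : ℝ) • (X - T) := by simp [iM]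
  have e2 : iP (eP.symm ⟨_, m2⟩) = (2⁻¹ : ℝ) • (X + T) := by simp [iP]
  have e3 : X = iM (eM.symm ⟨_, m1⟩) + iP (eP.symm ⟨_, m2⟩) := by
    rw [e1, e2]; module
  have e4 := hg' (eM.symm ⟨_, m1⟩) (eP.symm ⟨_, m2⟩)
  rw [← e3] at e4
  simp only [LinearMap.coe_toContinuousLinearMap', LinearMap.comp_apply, e4, LinearMap.fst_apply,
    LinearMap.snd_apply]
  exact e3.symm

variable (D : AntiSplitting A E F)

theorem commute_inM (w : E) : (A * A : R) * D.inM w = D.inM w * (A * A) := by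
  rw [mul_assoc, D.anti, mul_neg, ← mul_assoc, D.anti, neg_mul, neg_neg, mul_assoc]

theorem commute_inP (k : F) : (A * A : R) * D.inP k = D.inP k * (A * A) := by
  rw [mul_assoc, D.comm, ← mul_assoc, D.comm, mul_assoc]

/-- Split `W` by `decomp`: the anticommutator of `W` with `A` is twice `A` times the commuting
component, so that component vanishes. -/
theorem inM_prM {W : R} (h : A * W = -(W * A)) : D.inM (D.prM W) = W := by
  have h0 : (A * A : R) * W = W * (A * A) := by
    rw [mul_assoc, h, mul_neg, ← mul_assoc, h, neg_mul, neg_neg, mul_assoc]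
  have h1 := D.decomp W h0
  have h2 : (A : R) * W + W * A = (2 : ℝ) • (A * D.inP (D.prP W)) := by
    conv_lhs => rw [← h1, mul_add, add_mul, D.anti, D.comm]
    rw [D.comm]
    module
  rw [h, neg_add_cancel] at h2
  have h3 : D.inP (D.prP W) = 0 := by simpa using h2.symm
  simpa [h3] using h1

theorem inP_prP {W : R} (h : A * W = W * A) : D.inP (D.prP W) = W := by
  have h0 : (A * A : R) * W = W * (A * A) := by
    rw [mul_assoc, h, ← mul_assoc, h, mul_assoc]
  have h1 := D.decomp W h0
  have h2 : (A : R) * W - W * A = (2 : ℝ) • (A * D.inM (D.prM W)) := by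
    conv_lhs => rw [← h1, mul_add, add_mul, D.anti, D.comm]
    rw [D.anti]
    module
  rw [h, sub_self] at h2
  have h3 : D.inM (D.prM W) = 0 := by simpa using h2.symm
  simpa [h3] using h1

/-- The unit `1 + W`, where `W` anticommutes with `A`. -/
noncomputable def unitM (w : E) : Rˣ := Units.ofElem (1 + D.inM w)

/-- The unit with value `k`, where `k` commutes with `A`. -/
noncomputable def unitP (k : F) : Rˣ := Units.ofElem (D.inP k)

theorem unitM_mem (w : E) : D.unitM w ∈ grp A :=
  Units.ofElem_prop (· ∈ grp A) (one_mem _) fun u hu => by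
    rw [mem_grp, hu, mul_add, add_mul, D.commute_inM, mul_one, one_mul]

theorem unitP_comm (k : F) : D.unitP k ∈ Subgroup.centralizer {A} :=
  Units.ofElem_prop (· ∈ Subgroup.centralizer {A}) (one_mem _) fun u hu => by
    rw [Subgroup.mem_centralizer_singleton_iff, Units.ext_iff]
    simp [hu, D.comm]

theorem unitP_mem (k : F) : D.unitP k ∈ grp A := centralizer_le A (D.unitP_comm k)

theorem cayley_unitM {w : E} (hw : IsUnit (1 + D.inM w)) :
    IsUnit ((D.unitM w * A * (D.unitM w)⁻¹ : Rˣ) + A : R) ∧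
      cayley A ((D.unitM w * A * (D.unitM w)⁻¹ : Rˣ) : R) = D.inM w :=
  cayley_conj (D.anti w) (Units.val_ofElem hw)

/-- The orbit chart needs `1 + W` invertible and the ambient Cayley chart needs `1 - W` invertible;
these agree because `1 - W = A (1 + W) A⁻¹`. -/
theorem isUnit_one_sub_inM {w : E} (hw : IsUnit (1 + D.inM w)) : IsUnit (1 - D.inM w) := by
  have : (1 - D.inM w) = A * (1 + D.inM w) * (A⁻¹ : Rˣ) := by
    rw [Units.eq_mul_inv_iff_mul_eq, mul_add, D.anti, sub_mul]
    simp [sub_eq_add_neg]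
  rw [this]
  exact (A.isUnit.mul hw).mul A⁻¹.isUnit

/-! ### Cayley charts of the orbit -/

section Orbit

variable [CompleteSpace R]

theorem cayleyChart_unit (A P Y : Rˣ) :
    cayleyChart A P (Y : R) = cayley A ((P⁻¹ * Y * P : Rˣ) : R) := by
  rw [Units.val_mul, Units.val_mul]; rfl

/-- The chart of the orbit at `C X A X⁻¹ C⁻¹`. -/
noncomputable def orbitChart (C : Rˣ) (X : grp A) : OpenPartialHomeomorph (orbit A C) E where
  toFun Y := D.prM (cayleyChart A (C * X) (Y : Rˣ))
  invFun w := ⟨C * (X * D.unitM w) * A * (C * (X * D.unitM w))⁻¹,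
    mem_orbit (mul_mem X.2 (D.unitM_mem w))⟩
  source := {Y | IsUnit (((C * X)⁻¹ * Y * (C * X) : Rˣ) + A : R)}
  target := {w | IsUnit (1 + D.inM w)}
  map_source' Y hY := by
    obtain ⟨h1, -, h3⟩ := cayley_root (orbit_sq X.2 Y.2) hY
    change IsUnit (1 + D.inM (D.prM (cayleyChart A (C * X) (Y : Rˣ))))
    rwa [cayleyChart_unit, D.inM_prM h1]
  map_target' w hw := by
    have e : (C * (X : Rˣ))⁻¹ * (C * (X * D.unitM w) * A * (C * (X * D.unitM w))⁻¹) *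
        (C * (X : Rˣ)) = D.unitM w * A * (D.unitM w)⁻¹ := by group
    change IsUnit (((C * (X : Rˣ))⁻¹ * (C * (X * D.unitM w) * A * (C * (X * D.unitM w))⁻¹) *
        (C * (X : Rˣ)) : Rˣ) + A : R)
    rw [e]
    exact (D.cayley_unitM hw).1
  left_inv' Y hY := by
    -- For `Z` the translate of `Y` back by `C X` and `V = 1 + W`, the relation `V A = Z V` says
    -- that `V A V⁻¹ = Z`.
    obtain ⟨h1, h2, h3⟩ := cayley_root (orbit_sq X.2 Y.2) hY
    have h4 : (D.unitM (D.prM (cayleyChart A (C * X) (Y : Rˣ))) : R) =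
        1 + cayley A (((C * X)⁻¹ * Y * (C * X) : Rˣ) : R) := by
      rw [cayleyChart_unit, unitM, D.inM_prM h1, Units.val_ofElem h3]
    rw [← h4, ← Units.val_mul, ← Units.val_mul, ← Units.ext_iff] at h2
    apply Subtype.ext
    simp only [mul_inv_rev]
    generalize D.unitM _ = V at h2 ⊢
    calc _ = C * (X : Rˣ) * (V * A) * V⁻¹ * (X : Rˣ)⁻¹ * C⁻¹ := by group
      _ = _ := by rw [h2]; group
  right_inv' w hw := by
    have h := (D.cayley_unitM hw).2
    have e : (cayleyChart A (C * X)
        ((C * (X * D.unitM w) * A * (C * (X * D.unitM w))⁻¹ : Rˣ) : R)) =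
        cayley A ((D.unitM w * A * (D.unitM w)⁻¹ : Rˣ) : R) := by
      simp [cayleyChart, mul_assoc]
    rw [e, h, D.prM_inM]
  open_source := Units.isOpen.preimage (by fun_prop)
  open_target := Units.isOpen.preimage (by fun_prop)
  continuousOn_toFun := by
    refine D.prM.continuous.comp_continuousOn ((cayleyChart A (C * X)).continuousOn.comp
      (by fun_prop) fun Y hY => ?_)
    simpa [cayleyChart] using hY
  continuousOn_invFun := by
    have h : ContinuousOn D.unitM {w | IsUnit (1 + D.inM w)} :=
      Units.continuousOn_ofElem.comp (by fun_prop) fun w hw => hw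
    rw [Topology.IsInducing.subtypeVal.continuousOn_iff]
    simp only [Function.comp_def]
    fun_prop

/-- In the ambient Cayley coordinates the orbit is an open part of the linear subspace `D.inM`; this
is what makes it embedded. -/
theorem cayleyChart_orbitChart_symm (C : Rˣ) (X : grp A) {w : E} (hw : IsUnit (1 + D.inM w)) :
    cayleyChart A (C * X) (((D.orbitChart C X).symm w : Rˣ) : R) = D.inM w := by
  rw [← (D.cayley_unitM hw).2]
  simp [orbitChart, cayleyChart, mul_assoc]

/-- The atlas of the orbit. -/
noncomputable def orbitAtlas (C : Rˣ) : EmbeddedAtlas (orbit A C) R E (grp A) where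
  incl Y := (Y : Rˣ)
  chart := D.orbitChart C
  index Y := ⟨Y.2.choose, Y.2.choose_spec.1⟩
  mem_source Y := by
    have h := Y.2.choose_spec.2
    set X := Y.2.choose
    change IsUnit (((C * X)⁻¹ * Y * (C * X) : Rˣ) + A : R)
    -- The point translates back to `A` itself, and `A + A = 2 A` is invertible.
    have e : (C * X)⁻¹ * (Y : Rˣ) * (C * X) = A := by rw [h]; group
    rw [e, ← two_smul ℝ]
    exact A.isUnit.smul (Units.mk0 (2 : ℝ) two_ne_zero)
  ext X Y := D.prM (cayleyChart A (C * X) Y)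
  contDiffAt_ext X Y hY := by
    have h := contDiffAt_cayley A (Z := (((C * X)⁻¹ * Y * (C * X) : Rˣ) : R)) hY
    refine D.prM.contDiff.contDiffAt.comp _ ?_
    refine ContDiffAt.comp (g := cayley A)
      (f := fun Y : R => (((C * X)⁻¹ : Rˣ) : R) * Y * ((C * X : Rˣ) : R)) _ ?_ (by fun_prop)
    simpa using h
  chart_eq X Y hY := rfl
  contDiffOn_symm X := by
    -- The inverse orbit chart is the restriction of the inverse ambient chart to a linear subspace.
    have h : ContDiffOn ℝ ∞ (fun w => (cayleyChart A (C * X)).symm (D.inM w))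
        {w | IsUnit (1 + D.inM w)} := by
      intro w hw
      have h := contDiffAt_cayleyInv A (D.isUnit_one_sub_inM hw)
      have h' : ContDiffAt ℝ ∞ (fun w => cayleyInv A (D.inM w)) w :=
        ContDiffAt.comp w (g := cayleyInv A) h (by fun_prop)
      exact ContDiffAt.contDiffWithinAt
        (ContDiffAt.mul (ContDiffAt.mul contDiffAt_const h') contDiffAt_const)
    refine h.congr fun w hw => ?_
    rw [← D.cayleyChart_orbitChart_symm C X hw, OpenPartialHomeomorph.left_inv]
    · rfl
    · have := (D.orbitChart C X).map_target (x := w) hw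
      simpa [cayleyChart, orbitChart] using this

end Orbit

end AntiSplitting

/-! ### The centralizer as a Lie group, and the homogeneous space -/

namespace AntiSplitting

section Group

variable {R : Type*} [NormedRing R] {A : Rˣ}

/-- The stabilizer of `A` in the centralizer of `A ^ 2`. -/
abbrev stab (A : Rˣ) : Subgroup (grp A) := (Subgroup.centralizer {A}).subgroupOf (grp A)

/-- The action on the base point. -/
def orbitMap (A C : Rˣ) (X : grp A) : orbit A C := ⟨C * X * A * (C * X)⁻¹, mem_orbit X.2⟩

theorem orbitMap_eq_iff {C : Rˣ} {X Y : grp A} :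
    orbitMap A C X = orbitMap A C Y ↔ X⁻¹ * Y ∈ stab A := by
  rw [Subgroup.mem_subgroupOf, Subgroup.mem_centralizer_singleton_iff, Subtype.ext_iff]
  simp only [orbitMap, Subgroup.coe_mul, Subgroup.coe_inv, mul_inv_rev]
  generalize (X : Rˣ) = X
  generalize (Y : Rˣ) = Y
  constructor
  · intro h
    calc X⁻¹ * Y * A = X⁻¹ * C⁻¹ * (C * Y * A * (Y⁻¹ * C⁻¹)) * C * Y := by group
      _ = _ := by rw [← h]; group
  · intro h
    calc C * X * A * (X⁻¹ * C⁻¹) = C * X * (A * (X⁻¹ * Y)) * Y⁻¹ * C⁻¹ := by group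
      _ = _ := by rw [← h]; group

theorem continuous_orbitMap (C : Rˣ) : Continuous (orbitMap A C) := by
  unfold orbitMap
  fun_prop

/-- The bijection of the homogeneous space with the orbit. -/
noncomputable def quotientEquiv (A C : Rˣ) : (grp A ⧸ stab A) ≃ orbit A C :=
  Equiv.ofBijective
    (Quotient.lift (orbitMap A C) fun _ _ h =>
      orbitMap_eq_iff.2 (QuotientGroup.leftRel_apply.1 h))
    ⟨by
      rintro ⟨X⟩ ⟨Y⟩ h
      exact Quotient.sound (QuotientGroup.leftRel_apply.2 (orbitMap_eq_iff.1 h)), by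
      rintro ⟨Y, X, hX, rfl⟩
      exact ⟨QuotientGroup.mk (⟨X, hX⟩ : grp A), Subtype.ext (by
        change C * X * A * (C * X)⁻¹ = _
        group)⟩⟩

theorem quotientEquiv_mk (C : Rˣ) (X : grp A) :
    quotientEquiv A C (QuotientGroup.mk X) = orbitMap A C X := rfl

theorem anti_mul {W k : R} (hW : A * W = -(W * A)) (hk : A * k = k * A) :
    A * (W * k) = -(W * k * A) := by
  rw [← mul_assoc, hW, neg_mul, mul_assoc, hk, mul_assoc]

theorem comm_inverse {k : R} (hk : A * k = k * A) (h : IsUnit k) :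
    A * Ring.inverse k = Ring.inverse k * A := by
  obtain ⟨K, rfl⟩ := h
  rw [Ring.inverse_unit]
  exact (show Commute (A : R) K from hk).units_inv_right

end Group

variable {R : Type*} [NormedRing R] [NormedAlgebra ℝ R] {A : Rˣ} {E F V : Type*}
  [NormedAddCommGroup E] [NormedSpace ℝ E] [NormedAddCommGroup F] [NormedSpace ℝ F]
  [NormedAddCommGroup V] [NormedSpace ℝ V]
  (D : AntiSplitting A E F) (φ : V ≃L[ℝ] E × F)

/-- The linear parametrization of the centralizer of `A ^ 2`. -/
noncomputable def incl : V →L[ℝ] R := (D.inM.coprod D.inP) ∘L (φ : V →L[ℝ] E × F)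

/-- The inverse of the linear parametrization of the centralizer of `A ^ 2`. -/
noncomputable def proj : R →L[ℝ] V := (φ.symm : E × F →L[ℝ] V) ∘L (D.prM.prod D.prP)

theorem incl_apply (v : V) : D.incl φ v = D.inM (φ v).1 + D.inP (φ v).2 := by simp [incl]

theorem proj_apply (X : R) : D.proj φ X = φ.symm (D.prM X, D.prP X) := by simp [proj]

theorem proj_incl (v : V) : D.proj φ (D.incl φ v) = v := by
  simp [proj_apply, incl_apply, D.prM_inM, D.prM_inP, D.prP_inM, D.prP_inP]

theorem incl_proj {X : R} (hX : (A * A : R) * X = X * (A * A)) : D.incl φ (D.proj φ X) = X := by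
  simp [proj_apply, incl_apply, D.decomp X hX]

theorem ofElem_incl_mem (v : V) : Units.ofElem (D.incl φ v) ∈ grp A :=
  Units.ofElem_prop (· ∈ grp A) (one_mem _) fun u hu => by
    rw [mem_grp, hu, incl_apply, mul_add, add_mul, D.commute_inM, D.commute_inP]

/-- Write `Z = w + k` with `w` anticommuting and `k` commuting with `A`. If `k` is invertible, then
`Z = (1 + w k⁻¹) k`, and `w k⁻¹` still anticommutes with `A`. -/
theorem factor {Z : Rˣ} (hZ : Z ∈ grp A) (hk : IsUnit (D.inP (D.prP (Z : R)))) :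
    let W := D.inM (D.prM (Z : R)) * Ring.inverse (D.inP (D.prP (Z : R)))
    D.inM (D.prM W) = W ∧ (1 + W) * D.inP (D.prP (Z : R)) = Z ∧ IsUnit (1 + W) := by
  intro W
  have h1 : (1 + W) * D.inP (D.prP (Z : R)) = Z := by
    rw [add_mul, mul_assoc, Ring.inverse_mul_cancel _ hk, mul_one, one_mul, add_comm]
    exact D.decomp Z (mem_grp.1 hZ)
  refine ⟨D.inM_prM (anti_mul (D.anti _) (comm_inverse (D.comm _) hk)), h1, ?_⟩
  have h2 : 1 + W = Z * Ring.inverse (D.inP (D.prP (Z : R))) := by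
    calc 1 + W = (1 + W) * D.inP (D.prP (Z : R)) * Ring.inverse (D.inP (D.prP (Z : R))) := by
          rw [mul_assoc, Ring.mul_inverse_cancel _ hk, mul_one]
      _ = _ := by rw [h1]
  rw [h2]
  exact Z.isUnit.mul hk.ringInverse

theorem prP_mul (w : E) (k : F) : D.prP ((1 + D.inM w) * D.inP k) = k := by
  rw [add_mul, one_mul, map_add, D.prP_inP, ← D.inM_prM (anti_mul (D.anti w) (D.comm k)),
    D.prP_inM, add_zero]

theorem inM_prM_mul (w : E) (k : F) :
    D.inM (D.prM ((1 + D.inM w) * D.inP k)) = D.inM w * D.inP k := by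
  rw [add_mul, one_mul, map_add, D.prM_inP, zero_add,
    D.inM_prM (anti_mul (D.anti w) (D.comm k))]

variable [CompleteSpace R]

/-- The linear chart of the centralizer of `A ^ 2`. -/
noncomputable def grpChart : OpenPartialHomeomorph (grp A) V where
  toFun X := D.proj φ (X : Rˣ)
  invFun v := ⟨Units.ofElem (D.incl φ v), D.ofElem_incl_mem φ v⟩
  source := Set.univ
  target := {v | IsUnit (D.incl φ v)}
  map_source' X _ := by
    rw [Set.mem_ofPred_eq, D.incl_proj φ (mem_grp.1 X.2)]
    exact X.1.isUnit
  map_target' _ _ := Set.mem_univ _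
  left_inv' X _ := by
    apply Subtype.ext
    apply Units.ext
    have h := D.incl_proj φ (mem_grp.1 X.2)
    change (Units.ofElem (D.incl φ (D.proj φ (X : Rˣ))) : R) = (X : Rˣ)
    rw [h, Units.val_ofElem X.1.isUnit]
  right_inv' v hv := by
    rw [Units.val_ofElem hv, proj_incl]
  open_source := isOpen_univ
  open_target := Units.isOpen.preimage (by fun_prop)
  continuousOn_toFun := by fun_prop
  continuousOn_invFun := by
    rw [Topology.IsInducing.subtypeVal.continuousOn_iff]
    exact Units.continuousOn_ofElem.comp (by fun_prop) fun w hw => hw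

/-- The atlas of the centralizer of `A ^ 2` consisting of the linear chart. -/
noncomputable def grpAtlas : EmbeddedAtlas (grp A) R V Unit where
  incl X := (X : Rˣ)
  chart _ := D.grpChart φ
  index _ := ()
  mem_source _ := Set.mem_univ _
  ext _ := D.proj φ
  contDiffAt_ext _ _ _ := (D.proj φ).contDiff.contDiffAt
  chart_eq _ _ _ := rfl
  contDiffOn_symm _ := by
    refine (D.incl φ).contDiff.contDiffOn.congr fun v hv => ?_
    exact Units.val_ofElem hv

theorem isSmoothEmbedding_grp :
    letI := (D.grpAtlas φ).chartedSpace
    Manifold.IsSmoothEmbedding 𝓘(ℝ, V) 𝓘(ℝ, R) ∞ (Subtype.val : grp A → Rˣ) := by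
  let := (D.grpAtlas φ).chartedSpace
  have := (D.grpAtlas φ).isManifold
  refine ⟨?_, Topology.IsEmbedding.subtypeVal⟩
  -- `e` identifies `R` with `V × ker (D.proj φ)` and sends `D.incl φ v` to `(v, 0)`, so the
  -- inclusion becomes that of a linear slice.
  let e := ContinuousLinearEquiv.equivOfRightInverse (D.proj φ) (D.incl φ) (D.proj_incl φ)
  refine ⟨(D.proj φ : R →ₗ[ℝ] V).ker, inferInstance, inferInstance, fun X => ?_⟩
  refine Manifold.IsImmersionAtOfComplement.mk_of_continuousAt (by fun_prop) e.symm
    (D.grpChart φ) (chartAt R (1 : Rˣ)) (Set.mem_univ _) (Set.mem_univ _)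
    ((D.grpAtlas φ).chart_mem_maximalAtlas ()) (IsManifold.chart_mem_maximalAtlas _) ?_
  intro v hv
  have hv' : v ∈ (D.grpChart φ).target := by simpa using hv
  have h : (((D.grpChart φ).symm v : Rˣ) : R) = D.incl φ v := Units.val_ofElem hv'
  simpa [e, Units.chartAt_apply] using h

theorem isSmoothEmbedding_orbit (C : Rˣ) :
    letI := (D.orbitAtlas C).chartedSpace
    Manifold.IsSmoothEmbedding 𝓘(ℝ, E) 𝓘(ℝ, R) ∞ (Subtype.val : orbit A C → Rˣ) := by
  let := (D.orbitAtlas C).chartedSpace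
  have := (D.orbitAtlas C).isManifold
  refine ⟨?_, Topology.IsEmbedding.subtypeVal⟩
  -- As for the group, the slice is straightened linearly, but after passing to the Cayley chart of
  -- the units.
  let e := ContinuousLinearEquiv.equivOfRightInverse D.prM D.inM D.prM_inM
  refine ⟨(D.prM : R →ₗ[ℝ] E).ker, inferInstance, inferInstance, fun Y => ?_⟩
  have hY := (D.orbitAtlas C).mem_source Y
  set X := (D.orbitAtlas C).index Y
  refine Manifold.IsImmersionAtOfComplement.mk_of_continuousAt (by fun_prop) e.symm
    (D.orbitChart C X) (cayleyUnitsChart A (C * X)) hY ?_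
    ((D.orbitAtlas C).chart_mem_maximalAtlas X) (cayleyUnitsChart_mem_maximalAtlas _ _) ?_
  · have h : IsUnit (((C * X)⁻¹ * Y * (C * X) : Rˣ) + A : R) := hY
    rw [cayleyUnitsChart, OpenPartialHomeomorph.trans_source]
    refine ⟨Set.mem_univ _, ?_⟩
    rwa [Units.val_mul, Units.val_mul] at h
  · intro w hw
    have hw' : w ∈ (D.orbitChart C X).target := by simpa using hw
    have h := D.cayleyChart_orbitChart_symm C X hw'
    simpa [e, cayleyUnitsChart, Units.chartAt_apply] using h

theorem lieGroup_grp :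
    letI := (D.grpAtlas φ).chartedSpace
    LieGroup 𝓘(ℝ, V) ∞ (grp A) := by
  let := (D.grpAtlas φ).chartedSpace
  have := (D.grpAtlas φ).isManifold
  have hi : ContMDiff 𝓘(ℝ, V) 𝓘(ℝ, R) ∞ (fun X : grp A => ((X : Rˣ) : R)) :=
    (D.grpAtlas φ).contMDiff_incl
  have hmul : ContMDiffMul 𝓘(ℝ, V) ∞ (grp A) := by
    refine ⟨(D.grpAtlas φ).contMDiff_of_comp (by fun_prop) ?_⟩
    have h2 : ContMDiff 𝓘(ℝ, R × R) 𝓘(ℝ, R) ∞ (fun p : R × R => p.1 * p.2) :=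
      contDiff_mul.contMDiff
    exact h2.comp ((hi.comp contMDiff_fst).prodMk_space (hi.comp contMDiff_snd))
  refine ⟨(D.grpAtlas φ).contMDiff_of_comp continuous_inv fun X => ?_⟩
  have h : ContMDiffAt 𝓘(ℝ, R) 𝓘(ℝ, R) ∞ Ring.inverse ((X : Rˣ) : R) :=
    (contDiffAt_ringInverse ℝ (X : Rˣ)).contMDiffAt
  refine (h.comp X (hi X)).congr_of_eventuallyEq (Filter.Eventually.of_forall fun Y => ?_)
  simp [grpAtlas]

/-- The homeomorphism of the homogeneous space with the orbit. -/
noncomputable def quotientHomeomorph (C : Rˣ) : (grp A ⧸ stab A) ≃ₜ orbit A C where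
  toEquiv := quotientEquiv A C
  continuous_toFun := (continuous_orbitMap C).quotient_lift _
  continuous_invFun := by
    rw [continuous_iff_continuousAt]
    intro Y
    obtain ⟨X, hX⟩ : ∃ X, Y ∈ (D.orbitChart C X).source := ⟨_, (D.orbitAtlas C).mem_source Y⟩
    let c := D.orbitChart C X
    -- The inverse is continuous because `Y ↦ X (1 + W)`, with `W` the Cayley coordinate of `Y`, is
    -- a continuous local section of the orbit map.
    have h1 : ContinuousOn (fun Y : orbit A C => (QuotientGroup.mk
        (X * ⟨D.unitM (c Y), D.unitM_mem _⟩ : grp A) : grp A ⧸ stab A)) c.source := by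
      refine continuous_quotient_mk'.comp_continuousOn ?_
      rw [Topology.IsInducing.subtypeVal.continuousOn_iff]
      have h : ContinuousOn D.unitM {w | IsUnit (1 + D.inM w)} :=
        Units.continuousOn_ofElem.comp (by fun_prop) fun w hw => hw
      exact continuousOn_const.mul (h.comp c.continuousOn fun Y hY => c.map_source hY)
    refine (h1.continuousAt (c.open_source.mem_nhds hX)).congr ?_
    filter_upwards [c.open_source.mem_nhds hX] with Z hZ
    symm
    change (quotientEquiv A C).symm Z = _
    rw [Equiv.symm_apply_eq, quotientEquiv_mk]
    exact (c.left_inv hZ).symm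

/-- The map `(1 + W) k ↦ (W, k)`. -/
noncomputable def factorMap (Z : R) : V :=
  φ.symm (D.prM (D.inM (D.prM Z) * Ring.inverse (D.inP (D.prP Z))), D.prP Z)

theorem contDiffAt_factorMap {Z : R} (hZ : IsUnit (D.inP (D.prP Z))) :
    ContDiffAt ℝ ∞ (D.factorMap φ) Z := by
  obtain ⟨U, hU⟩ := hZ
  have h : ContDiffAt ℝ ∞ (fun Z : R => Ring.inverse (D.inP (D.prP Z))) Z :=
    ContDiffAt.comp Z (g := Ring.inverse) (f := fun Z : R => D.inP (D.prP Z))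
      (hU ▸ contDiffAt_ringInverse ℝ U) (by fun_prop)
  unfold factorMap
  fun_prop

theorem factorMap_mul {w : E} {k : F} (hk : IsUnit (D.inP k)) :
    D.factorMap φ ((1 + D.inM w) * D.inP k) = φ.symm (w, k) := by
  rw [factorMap, D.prP_mul, D.inM_prM_mul, mul_assoc, Ring.mul_inverse_cancel _ hk, mul_one,
    D.prM_inM]

/-- The chart `(1 + W) k ↦ (W, k)` of the centralizer of `A ^ 2`, translated by `X₀`. -/
noncomputable def factorChart (X₀ : grp A) : OpenPartialHomeomorph (grp A) V where
  toFun X := D.factorMap φ ((X₀⁻¹ * X : grp A) : Rˣ)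
  invFun v := X₀ * ⟨D.unitM (φ v).1 * D.unitP (φ v).2,
    mul_mem (D.unitM_mem _) (D.unitP_mem _)⟩
  source := {X | IsUnit (D.inP (D.prP ((X₀⁻¹ * X : grp A) : Rˣ)))}
  target := {v | IsUnit (1 + D.inM (φ v).1) ∧ IsUnit (D.inP (φ v).2)}
  map_source' X hX := by
    obtain ⟨h1, h2, h3⟩ := D.factor (X₀⁻¹ * X).2 hX
    simp only [factorMap, Set.mem_ofPred_eq, ContinuousLinearEquiv.apply_symm_apply]
    exact ⟨by rw [h1]; exact h3, hX⟩
  map_target' v hv := by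
    simp only [Set.mem_ofPred_eq, inv_mul_cancel_left, Units.val_mul, unitM, unitP,
      Units.val_ofElem hv.1, Units.val_ofElem hv.2, D.prP_mul, hv.2]
  left_inv' X hX := by
    obtain ⟨h1, h2, h3⟩ := D.factor (X₀⁻¹ * X).2 hX
    rw [← eq_inv_mul_iff_mul_eq]
    apply Subtype.ext
    apply Units.ext
    simp only [factorMap, ContinuousLinearEquiv.apply_symm_apply, Units.val_mul, unitM, unitP]
    rw [h1, Units.val_ofElem h3, Units.val_ofElem hX, h2]
  right_inv' v hv := by
    simp only [inv_mul_cancel_left, Units.val_mul, unitM, unitP,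
      Units.val_ofElem hv.1, Units.val_ofElem hv.2, D.factorMap_mul φ hv.2]
    simp
  open_source := Units.isOpen.preimage (by fun_prop)
  open_target := (Units.isOpen.preimage (by fun_prop)).inter (Units.isOpen.preimage (by fun_prop))
  continuousOn_toFun X hX := by
    have h := (D.contDiffAt_factorMap φ hX).continuousAt
    exact (ContinuousAt.comp (f := fun X : grp A => (((X₀⁻¹ * X : grp A) : Rˣ) : R)) h
      (by fun_prop)).continuousWithinAt
  continuousOn_invFun := by
    refine continuousOn_const.mul ?_
    rw [Topology.IsInducing.subtypeVal.continuousOn_iff]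
    exact (Units.continuousOn_ofElem.comp (by fun_prop) fun v hv => hv.1).mul
      (Units.continuousOn_ofElem.comp (by fun_prop) fun v hv => hv.2)

theorem factorChart_mem_maximalAtlas (X₀ : grp A) :
    letI := (D.grpAtlas φ).chartedSpace
    D.factorChart φ X₀ ∈ IsManifold.maximalAtlas 𝓘(ℝ, V) ∞ (grp A) := by
  refine (D.grpAtlas φ).mem_maximalAtlas _
    (fun Z => D.factorMap φ (((X₀⁻¹ : grp A) : Rˣ) * Z)) ?_ (fun X hX => rfl) ?_
  · intro X hX
    exact ContDiffAt.comp (g := D.factorMap φ)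
      (f := fun Z : R => (((X₀⁻¹ : grp A) : Rˣ) : R) * Z) _ (D.contDiffAt_factorMap φ hX)
      (by fun_prop)
  · have h : ContDiffOn ℝ ∞
        (fun v => ((X₀ : Rˣ) : R) * ((1 + D.inM (φ v).1) * D.inP (φ v).2))
        (D.factorChart φ X₀).target := by fun_prop
    refine h.congr fun v hv => ?_
    change (((X₀ : Rˣ) * (D.unitM (φ v).1 * D.unitP (φ v).2) : Rˣ) : R) = _
    rw [Units.val_mul, Units.val_mul, unitM, unitP, Units.val_ofElem hv.1,
      Units.val_ofElem hv.2]

/-- The atlas of the homogeneous space. -/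
noncomputable def quotientAtlas (C : Rˣ) : EmbeddedAtlas (grp A ⧸ stab A) R E (grp A) :=
  (D.orbitAtlas C).pullback (D.quotientHomeomorph C)

/-- With `factorChart` on the group and the Cayley chart on the quotient, the projection is `(W, k)
↦ W`: since `k` commutes with `A`, it drops out of `(1 + W) k A k⁻¹ (1 + W)⁻¹`. -/
theorem isSubmersion_mk (C : Rˣ) :
    letI := (D.grpAtlas φ).chartedSpace
    letI := (D.quotientAtlas C).chartedSpace
    Manifold.IsSubmersionOfComplement F 𝓘(ℝ, V) 𝓘(ℝ, E) ∞
      (QuotientGroup.mk : grp A → grp A ⧸ stab A) := by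
  let := (D.grpAtlas φ).chartedSpace
  let := (D.quotientAtlas C).chartedSpace
  intro X₀
  have hone : D.inP (D.prP 1) = 1 := D.inP_prP (by simp)
  refine Manifold.IsSubmersionAtOfComplement.mk_of_continuousAt
    continuous_quotient_mk'.continuousAt φ (D.factorChart φ X₀)
    ((D.quotientAtlas C).chart X₀) ?_ ?_ (D.factorChart_mem_maximalAtlas φ X₀)
    ((D.quotientAtlas C).chart_mem_maximalAtlas X₀) ?_
  · change IsUnit (D.inP (D.prP ((X₀⁻¹ * X₀ : grp A) : Rˣ)))
    simp [hone]
  · change QuotientGroup.mk X₀ ∈ ((D.quotientHomeomorph C).toOpenPartialHomeomorph.trans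
      (D.orbitChart C X₀)).source
    rw [OpenPartialHomeomorph.trans_source]
    refine ⟨Set.mem_univ _, ?_⟩
    change IsUnit (((C * X₀)⁻¹ * (C * X₀ * A * (C * X₀)⁻¹) * (C * X₀) : Rˣ) + A : R)
    have e : (C * (X₀ : Rˣ))⁻¹ * (C * (X₀ : Rˣ) * A * (C * (X₀ : Rˣ))⁻¹) * (C * (X₀ : Rˣ)) = A := by
      group
    rw [e, ← two_smul ℝ]
    exact A.isUnit.smul (Units.mk0 (2 : ℝ) two_ne_zero)
  · intro v hv
    have hv' : v ∈ (D.factorChart φ X₀).target := by simpa using hv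
    simp only [OpenPartialHomeomorph.extend_coe, OpenPartialHomeomorph.extend_coe_symm,
      modelWithCornersSelf_coe, modelWithCornersSelf_coe_symm, Function.comp_apply, id]
    set T : Rˣ := C * (X₀ * (D.unitM (φ v).1 * D.unitP (φ v).2)) with hT
    change D.prM (cayleyChart A (C * X₀) ((T * A * T⁻¹ : Rˣ) : R)) = _
    have hk : D.unitP (φ v).2 * A = A * D.unitP (φ v).2 :=
      Subgroup.mem_centralizer_singleton_iff.1 (D.unitP_comm _)
    have e : (C * (X₀ : Rˣ))⁻¹ * (T * A * T⁻¹) * (C * (X₀ : Rˣ)) =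
        D.unitM (φ v).1 * A * (D.unitM (φ v).1)⁻¹ := by
      rw [hT]
      generalize D.unitP (φ v).2 = k at hk
      generalize D.unitM (φ v).1 = m
      calc _ = m * (k * A) * k⁻¹ * m⁻¹ := by group
        _ = _ := by rw [hk]; group
    rw [cayleyChart_unit, e, (D.cayley_unitM hv'.1).2, D.prM_inM]

end AntiSplitting

/-- The orbit of `A` under the conjugation by `C X`, `X` in the centralizer of `A ^ 2`, is an
embedded submanifold, diffeomorphic to the homogeneous space. -/
theorem exists_orbit_structures {R : Type*} [NormedRing R] [NormedAlgebra ℝ R]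
    [FiniteDimensional ℝ R] [CompleteSpace R] (A C : Rˣ) :
    ∃ (d a b : ℕ) (_ : ChartedSpace (EuclideanSpace ℝ (Fin d)) (AntiSplitting.orbit A C))
      (_ : ChartedSpace (EuclideanSpace ℝ (Fin a)) (AntiSplitting.grp A))
      (_ : ChartedSpace (EuclideanSpace ℝ (Fin b))
        (AntiSplitting.grp A ⧸ AntiSplitting.stab A)),
      (IsManifold (𝓡 d) ∞ (AntiSplitting.orbit A C) ∧
        Manifold.IsSmoothEmbedding (𝓡 d) 𝓘(ℝ, R) ∞
          (Subtype.val : AntiSplitting.orbit A C → Rˣ)) ∧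
      (LieGroup (𝓡 a) ∞ (AntiSplitting.grp A) ∧
        Manifold.IsSmoothEmbedding (𝓡 a) 𝓘(ℝ, R) ∞
          (Subtype.val : AntiSplitting.grp A → Rˣ)) ∧
      (IsManifold (𝓡 b) ∞ (AntiSplitting.grp A ⧸ AntiSplitting.stab A) ∧
        Manifold.IsSubmersion (𝓡 a) (𝓡 b) ∞ (QuotientGroup.mk :
          AntiSplitting.grp A → AntiSplitting.grp A ⧸ AntiSplitting.stab A)) ∧
      Nonempty (Diffeomorph (𝓡 d) (𝓡 b) (AntiSplitting.orbit A C)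
        (AntiSplitting.grp A ⧸ AntiSplitting.stab A) ∞) := by
  obtain ⟨d, c, ⟨D⟩⟩ := AntiSplitting.exists_euclidean A
  -- The group is modelled on the product of the two eigenspaces, here identified with a single
  -- Euclidean space.
  let φ : EuclideanSpace ℝ (Fin (d + c)) ≃L[ℝ]
      EuclideanSpace ℝ (Fin d) × EuclideanSpace ℝ (Fin c) :=
    ContinuousLinearEquiv.ofFinrankEq (by simp)
  exact ⟨d, d + c, d, (D.orbitAtlas C).chartedSpace, (D.grpAtlas φ).chartedSpace,
    (D.quotientAtlas C).chartedSpace,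
    ⟨(D.orbitAtlas C).isManifold, D.isSmoothEmbedding_orbit C⟩,
    ⟨D.lieGroup_grp φ, D.isSmoothEmbedding_grp φ⟩,
    ⟨(D.quotientAtlas C).isManifold,
      ⟨_, inferInstance, inferInstance, D.isSubmersion_mk φ C⟩⟩,
    ⟨(D.orbitAtlas C).diffeomorph (D.quotientHomeomorph C)⟩⟩

/-! ### Semisimple square roots and similarity over `ℝ` -/

open Polynomial in
/-- If `p` is separable and `p 0 ≠ 0`, then `p (X ^ 2)` is separable. -/
theorem Polynomial.Separable.comp_X_sq {K : Type*} [Field K] (h2 : (2 : K) ≠ 0) {p : K[X]}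
    (hp : p.Separable) (h0 : p.eval 0 ≠ 0) : (p.comp (X ^ 2)).Separable := by
  -- The derivative is `2 X * p' (X ^ 2)`. A Bézout identity for `p` and `p'` survives the
  -- substitution, and `2 X` is coprime to `p (X ^ 2)` because `p 0 ≠ 0`.
  rw [Polynomial.Separable, derivative_comp]
  have h1 : IsCoprime (p.comp (X ^ 2)) ((derivative p).comp (X ^ 2)) := by
    obtain ⟨a, b, h⟩ := hp
    refine ⟨a.comp (X ^ 2), b.comp (X ^ 2), ?_⟩
    rw [← mul_comp, ← mul_comp, ← add_comp, h, one_comp]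
  have h3 : IsCoprime (p.comp (X ^ 2)) (derivative (X ^ 2 : K[X])) := by
    have e : derivative (X ^ 2 : K[X]) = C 2 * X := by simp [one_add_one_eq_two]
    rw [e]
    rw [isCoprime_mul_unit_left_right (isUnit_C.2 h2.isUnit)]
    · refine (Irreducible.coprime_iff_not_dvd irreducible_X).2 ?_ |>.symm
      rw [X_dvd_iff, coeff_zero_eq_eval_zero]
      simpa using h0
  exact h3.mul_right h1

namespace Matrix

open Polynomial

theorem _root_.Module.End.IsSemisimple.exists_basis {K V : Type*} [Field K] [IsAlgClosed K]
    [AddCommGroup V] [Module K V] [FiniteDimensional K V] {f : Module.End K V}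
    (h : f.IsSemisimple) {n : ℕ} (hn : Module.finrank K V = n) :
    ∃ (b : Module.Basis (Fin n) K V) (d : Fin n → K), ∀ i, f (b i) = d i • b i := by
  classical
  have hint := DirectSum.isInternal_submodule_of_iSupIndep_of_iSup_eq_top
    (Module.End.eigenspaces_iSupIndep f) h.iSup_eigenspace_eq_top
  let b := hint.collectedBasis fun μ => Module.Free.chooseBasis K (f.eigenspace μ)
  have hb : ∀ i, f (b i) = i.1 • b i := fun i =>
    Module.End.mem_eigenspace_iff.1 (hint.collectedBasis_mem _ i)
  clear_value b
  let e := b.indexEquiv (Module.finBasisOfFinrankEq K V hn)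
  exact ⟨b.reindex e, fun i => (e.symm i).1, fun i => by simp [hb]⟩

theorem exists_mul_eq_mul_diagonal {K : Type*} [Field K] [IsAlgClosed K] {n : ℕ}
    {A : Matrix (Fin n) (Fin n) K} (h : Module.End.IsSemisimple (Matrix.toLin' A)) :
    ∃ (P : (Matrix (Fin n) (Fin n) K)ˣ) (d : Fin n → K), A * P = P * diagonal d := by
  obtain ⟨b, d, hb⟩ := h.exists_basis (n := n) (by simp)
  refine ⟨⟨(Pi.basisFun K (Fin n)).toMatrix b, b.toMatrix (Pi.basisFun K (Fin n)),
    Module.Basis.toMatrix_mul_toMatrix_flip _ _, Module.Basis.toMatrix_mul_toMatrix_flip _ _⟩,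
    d, ?_⟩
  ext i j
  have h1 := congrFun (hb j) i
  rw [mul_diagonal]
  simp only [toLin'_apply, mulVec, dotProduct, Pi.smul_apply, smul_eq_mul] at h1
  simpa [mul_apply, Module.Basis.toMatrix_apply, mul_comm] using h1

/-- Diagonalizable matrices with the same characteristic polynomial are similar. -/
theorem exists_conj_of_charpoly_eq {K : Type*} [Field K] [IsAlgClosed K] {n : ℕ}
    {A B : Matrix (Fin n) (Fin n) K} (hA : Module.End.IsSemisimple (Matrix.toLin' A))
    (hB : Module.End.IsSemisimple (Matrix.toLin' B)) (h : A.charpoly = B.charpoly) :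
    ∃ P : (Matrix (Fin n) (Fin n) K)ˣ, A * P = P * B := by
  classical
  obtain ⟨P, d, hP⟩ := exists_mul_eq_mul_diagonal hA
  obtain ⟨Q, d', hQ⟩ := exists_mul_eq_mul_diagonal hB
  have hroots : ∀ {A : Matrix (Fin n) (Fin n) K} {P : (Matrix (Fin n) (Fin n) K)ˣ}
      {d : Fin n → K}, A * P = P * diagonal d →
      A.charpoly.roots = Finset.univ.val.map d := by
    intro A P d hP
    rw [← Units.eq_mul_inv_iff_mul_eq] at hP
    rw [hP, coe_units_inv, charpoly_units_conj, charpoly_diagonal]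
    refine Eq.trans ?_ (roots_multiset_prod_X_sub_C (Finset.univ.val.map d))
    rw [Multiset.map_map]
    rfl
  have hcard : ∀ c, Fintype.card {i // d i = c} = Fintype.card {i // d' i = c} := by
    intro c
    have h1 := congrArg (Multiset.count c) ((hroots hP).symm.trans (h ▸ hroots hQ))
    rw [Multiset.count_map, Multiset.count_map] at h1
    simpa only [Fintype.card_subtype, Finset.card, Finset.filter_val, eq_comm] using h1
  -- The two diagonals take each value equally often, so a permutation matches them; its matrix `T`
  -- intertwines the diagonal matrices.
  let σ : Fin n ≃ Fin n := Equiv.ofFiberEquiv fun c => Fintype.equivOfCardEq (hcard c)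
  have hσ : ∀ i, d' (σ i) = d i := Equiv.ofFiberEquiv_map _
  let T : (Matrix (Fin n) (Fin n) K)ˣ :=
    ⟨(1 : Matrix (Fin n) (Fin n) K).submatrix σ id, (1 : Matrix (Fin n) (Fin n) K).submatrix id σ,
      by rw [← submatrix_mul _ _ _ _ _ Function.bijective_id]; simp,
      by rw [submatrix_mul_equiv]; simp⟩
  have hT : diagonal d * (T : Matrix (Fin n) (Fin n) K) = T * diagonal d' := by
    ext i j
    rw [diagonal_mul, mul_diagonal]
    by_cases hij : σ i = j
    · simp [T, ← hij, hσ, mul_comm]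
    · simp [T, hij]
  refine ⟨P * T * Q⁻¹, ?_⟩
  have hQ' : diagonal d' * (Q⁻¹ : (Matrix (Fin n) (Fin n) K)ˣ) =
      (Q⁻¹ : (Matrix (Fin n) (Fin n) K)ˣ) * B := by
    rw [Units.mul_inv_eq_iff_eq_mul, mul_assoc, hQ, Units.inv_mul_cancel_left]
  rw [Units.val_mul, Units.val_mul, mul_assoc _ _ B, ← hQ', ← mul_assoc, ← mul_assoc, hP,
    mul_assoc _ (diagonal d), hT]
  simp only [mul_assoc]

/-- Real matrices which are similar over `ℂ` are similar over `ℝ`. -/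
theorem exists_real_conj {n : ℕ} {A B : Matrix (Fin n) (Fin n) ℝ}
    (P : (Matrix (Fin n) (Fin n) ℂ)ˣ)
    (h : A.map (algebraMap ℝ ℂ) * P = P * B.map (algebraMap ℝ ℂ)) :
    ∃ Q : (Matrix (Fin n) (Fin n) ℝ)ˣ, A * Q = Q * B := by
  let S : Matrix (Fin n) (Fin n) ℝ := (P : Matrix (Fin n) (Fin n) ℂ).map Complex.re
  let T : Matrix (Fin n) (Fin n) ℝ := (P : Matrix (Fin n) (Fin n) ℂ).map Complex.im
  have hS : A * S = S * B := by
    ext i j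
    have h1 := congrArg Complex.re (congrFun (congrFun h i) j)
    simpa [mul_apply, S] using h1
  have hT : A * T = T * B := by
    ext i j
    have h1 := congrArg Complex.im (congrFun (congrFun h i) j)
    simpa [mul_apply, T] using h1
  -- Every `S + t T` with `t` real intertwines `A` and `B`. Its determinant is a polynomial in `t`
  -- whose value at `I` is `det P ≠ 0`, so it is nonzero at some real `t`.
  let p : ℝ[X] := (S.map C + (X : ℝ[X]) • T.map C).det
  have hp : p ≠ 0 := by
    intro h0
    have h1 : (P : Matrix (Fin n) (Fin n) ℂ).det = aeval Complex.I p := by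
      rw [AlgHom.map_det]
      congr 1
      ext i j
      simp [S, T, Complex.re_add_im]
    rw [h0, map_zero] at h1
    exact ((isUnit_iff_isUnit_det _).1 P.isUnit).ne_zero h1
  obtain ⟨t, ht⟩ : ∃ t, p.eval t ≠ 0 := by
    by_contra! h0
    exact hp (Polynomial.funext (by simpa using h0))
  have hdet : (S + t • T).det ≠ 0 := by
    refine ne_of_eq_of_ne ?_ ht
    rw [← coe_evalRingHom, RingHom.map_det]
    congr 1
    ext i j
    simp
    exact mul_comm _ _
  refine ⟨((isUnit_iff_isUnit_det _).2 hdet.isUnit).unit, ?_⟩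
  rw [IsUnit.unit_spec, mul_add, add_mul, hS, mul_smul_comm, hT, smul_mul_assoc]

/-- Complexifications of square roots of nonsingular semisimple real matrices are semisimple. -/
theorem isSemisimple_of_sq {n : ℕ} {Y M : Matrix (Fin n) (Fin n) ℝ} (hM : IsUnit M)
    (hss : Module.End.IsSemisimple (Matrix.toLin' M)) (h : Y * Y = M) :
    Module.End.IsSemisimple (Matrix.toLin' (Y.map (algebraMap ℝ ℂ))) := by
  set p := minpoly ℝ (Matrix.toLin' M)
  -- Separability is what passes both to `p (X ^ 2)` and to the extension `ℂ` of `ℝ`.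
  have hp : p.Separable := PerfectField.separable_iff_squarefree.2 hss.minpoly_squarefree
  have h0 : p.eval 0 ≠ 0 := by
    intro h0
    have h1 : (0 : ℝ) ∈ spectrum ℝ (Matrix.toLin' M) := by
      rw [← Module.End.hasEigenvalue_iff_mem_spectrum]
      exact Module.End.hasEigenvalue_of_isRoot h0
    rw [spectrum.zero_mem_iff] at h1
    exact h1 (hM.map Matrix.toLinAlgEquiv')
  have hq := (hp.comp_X_sq two_ne_zero h0).map (f := algebraMap ℝ ℂ)
  refine Module.End.isSemisimple_of_squarefree_aeval_eq_zero hq.squarefree ?_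
  have h1 : aeval M p = 0 := by
    apply Matrix.toLinAlgEquiv'.injective
    rw [← AlgEquiv.coe_toAlgHom, ← aeval_algHom_apply, map_zero]
    exact minpoly.aeval _ _
  have h2 : aeval Y (p.comp (X ^ 2)) = 0 := by
    rw [aeval_comp]; simpa [pow_two, h] using h1
  have h3 : aeval (Y.map (algebraMap ℝ ℂ)) ((p.comp (X ^ 2)).map (algebraMap ℝ ℂ)) = 0 := by
    have h3 := map_aeval_eq_aeval_map (φ := algebraMap ℝ ℂ)
      (ψ := (algebraMap ℝ ℂ).mapMatrix (m := Fin n)) (by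
        ext x i j; by_cases hij : i = j <;> simp [algebraMap_matrix_apply, hij])
      (p.comp (X ^ 2)) Y
    rw [h2, map_zero] at h3
    exact h3.symm
  have h4 := congrArg (Matrix.toLinAlgEquiv' (R := ℂ)) h3
  rw [← AlgEquiv.coe_toAlgHom, ← aeval_algHom_apply, map_zero] at h4
  exact h4

end Matrix

/-! ### Characteristic polynomials of block diagonal matrices -/

namespace Matrix

open Polynomial

/-- The order on the indices serves only to regard the matrix as block triangular. -/
theorem det_blockDiagonal' {o : Type*} [Fintype o] [LinearOrder o] {m' : o → Type*}
    [∀ i, Fintype (m' i)] [∀ i, DecidableEq (m' i)] {R : Type*} [CommRing R]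
    (M : ∀ i, Matrix (m' i) (m' i) R) : (blockDiagonal' M).det = ∏ i, (M i).det := by
  rw [(blockTriangular_blockDiagonal' M).det_fintype]
  refine Finset.prod_congr rfl fun i _ => ?_
  rw [← det_submatrix_equiv_self (Equiv.sigmaSubtype i).symm]
  congr 1
  ext j k
  exact blockDiagonal'_apply_eq M i j k

theorem charpoly_blockDiagonal' {o : Type*} [Fintype o] [LinearOrder o] {m' : o → Type*}
    [∀ i, Fintype (m' i)] [∀ i, DecidableEq (m' i)] {R : Type*} [CommRing R]
    (M : ∀ i, Matrix (m' i) (m' i) R) : (blockDiagonal' M).charpoly = ∏ i, (M i).charpoly := by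
  have : (blockDiagonal' M).charmatrix = blockDiagonal' fun i => (M i).charmatrix := by
    ext ⟨i, j⟩ ⟨i', j'⟩
    by_cases h : i = i'
    · subst h
      simp [charmatrix, blockDiagonal'_apply_eq, diagonal_apply]
    · have h' : (⟨i, j⟩ : Σ i, m' i) ≠ ⟨i', j'⟩ := fun e => h (congrArg Sigma.fst e)
      simp [charmatrix, blockDiagonal'_apply_ne _ _ _ h, diagonal_apply_ne _ h']
  rw [charpoly, this, det_blockDiagonal']
  rfl

end Matrix

/-! ### The square and the eigenvalues of the auxiliary form -/

namespace SqrtStrata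

theorem rot_mul (a b : ℝ) : rot a * rot b = rot (a + b) := by
  ext i j
  fin_cases i <;> fin_cases j <;>
    simp [rot, Real.cos_add, Real.sin_add, Matrix.mul_apply, Fin.sum_univ_two] <;> ring

theorem rot_sub_two_pi (a : ℝ) : rot (a - 2 * Real.pi) = rot a := by
  simp [rot]

theorem rot_pi : rot Real.pi = -1 := by
  ext i j
  fin_cases i <;> fin_cases j <;> simp [rot]

open Polynomial in
-- Trace and determinant are the sum and the product of the two roots, which are written by real and
-- imaginary parts so as to match `EigData.rootVal`.
theorem charpoly_smul_rot (r a : ℝ) :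
    (r • rot a).charpoly.map (algebraMap ℝ ℂ) =
      (X - C (⟨r * Real.cos a, r * Real.sin a⟩ : ℂ)) *
        (X - C (⟨r * Real.cos a, -(r * Real.sin a)⟩ : ℂ)) := by
  have h1 : (⟨r * Real.cos a, r * Real.sin a⟩ : ℂ) + ⟨r * Real.cos a, -(r * Real.sin a)⟩ =
      ((r • rot a).trace : ℝ) := by
    apply Complex.ext
    · rw [Complex.ofReal_re, Matrix.trace_fin_two]
      simp [rot]
    · simp
  have h2 : (⟨r * Real.cos a, r * Real.sin a⟩ : ℂ) * ⟨r * Real.cos a, -(r * Real.sin a)⟩ =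
      ((r • rot a).det : ℝ) := by
    apply Complex.ext
    · rw [Complex.ofReal_re, Matrix.det_fin_two, Complex.mul_re]
      simp only [rot, Matrix.smul_apply, smul_eq_mul, Matrix.of_apply, Matrix.cons_val]
      ring
    · rw [Complex.ofReal_im, Complex.mul_im]
      ring
  rw [Matrix.charpoly_fin_two]
  simp only [Polynomial.map_add, Polynomial.map_sub, Polynomial.map_mul, Polynomial.map_pow,
    map_X, map_C, Complex.coe_algebraMap, ← h1, ← h2, C_add, C_mul]
  ring

namespace EigData

variable (D : EigData) {n : ℕ} (hD : D.order = n)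

theorem directSum_mul (A A' : ∀ i, Matrix (Fin (D.h i)) (Fin (D.h i)) ℝ)
    (B B' : ∀ l t, Fin (D.m l t) → Matrix (Fin 2) (Fin 2) ℝ)
    (N N' : ∀ i, Fin (D.k i) → Matrix (Fin 2) (Fin 2) ℝ) :
    D.directSum hD A B N * D.directSum hD A' B' N' =
      D.directSum hD (fun i => A i * A' i) (fun l t j => B l t j * B' l t j)
        (fun i j => N i j * N' i j) := by
  simp only [directSum, Matrix.reindex_apply, Matrix.submatrix_mul_equiv,
    Matrix.fromBlocks_multiply, Matrix.blockDiagonal'_mul, Matrix.mul_zero, Matrix.zero_mul,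
    add_zero, zero_add]

theorem charpoly_directSum (A : ∀ i, Matrix (Fin (D.h i)) (Fin (D.h i)) ℝ)
    (B : ∀ l t, Fin (D.m l t) → Matrix (Fin 2) (Fin 2) ℝ)
    (N : ∀ i, Fin (D.k i) → Matrix (Fin 2) (Fin 2) ℝ) :
    (D.directSum hD A B N).charpoly = (∏ i, (A i).charpoly) *
      ((∏ l, ∏ t, ∏ j, (B l t j).charpoly) * ∏ i, ∏ j, (N i j).charpoly) := by
  simp only [directSum, Matrix.charpoly_reindex, Matrix.charpoly_fromBlocks_zero₁₂,
    Matrix.charpoly_blockDiagonal']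

/-- The conditions on the listed eigenvalues in the real Jordan standard form. -/
structure Valid : Prop where
  lam_inj : Function.Injective D.lam
  lam_pos : ∀ i, 0 < D.lam i
  theta_inj : Function.Injective D.theta
  theta_pos : ∀ l, 0 < D.theta l
  theta_lt : ∀ l, D.theta l < Real.pi
  rho_inj : ∀ l, Function.Injective (D.rho l)
  rho_pos : ∀ l t, 0 < D.rho l t
  zeta_inj : Function.Injective D.zeta
  zeta_pos : ∀ i, 0 < D.zeta i

variable {D}

/-- Squaring doubles the angles block by block: both `θ / 2` and `θ / 2 - π` give `θ`, and `π / 2`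
gives `π`, that is `-1`. -/
theorem aux_mul_self (h : D.Valid) (u : Fin D.p → ℕ) (μ : ∀ l, Fin (D.s l) → ℕ) :
    D.aux hD u μ * D.aux hD u μ = D.jordan hD := by
  rw [aux, jordan, directSum_mul]
  congr 1
  · funext i
    rw [Matrix.smul_mul, Matrix.mul_smul, smul_smul, Real.mul_self_sqrt (h.lam_pos i).le,
      Matrix.diagonal_mul_diagonal, ← Matrix.diagonal_one]
    congr 2
    funext j
    split_ifs <;> simp
  · funext l t j
    rw [Matrix.smul_mul, Matrix.mul_smul, smul_smul, Real.mul_self_sqrt (h.rho_pos l t).le]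
    congr 1
    split_ifs
    · rw [rot_mul, add_halves]
    · rw [rot_mul, ← rot_sub_two_pi (D.theta l)]
      congr 1
      ring
  · funext i j
    rw [Matrix.smul_mul, Matrix.mul_smul, smul_smul, Real.mul_self_sqrt (h.zeta_pos i).le,
      rot_mul, add_halves, rot_pi]
    simp

variable (D)

/-- Labels of the possible eigenvalues of the square roots. -/
abbrev Label : Type :=
  (Fin D.p × Bool) ⊕ (((Σ l : Fin D.r, Fin (D.s l)) × Bool × Bool) ⊕ (Fin D.q × Bool))

/-- The sign of a Boolean. -/
def sgn (b : Bool) : ℝ := if b then 1 else -1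

/-- The eigenvalue with a given label. -/
noncomputable def rootVal : D.Label → ℂ
  | .inl (i, b) => ⟨sgn b * √(D.lam i), 0⟩
  -- The sign of `b` separates `θ / 2` from `θ / 2 - π`, whose exponentials are opposite; the sign
  -- of `e` then selects one of two conjugate values.
  | .inr (.inl (⟨l, t⟩, b, e)) => ⟨sgn b * (√(D.rho l t) * Real.cos (D.theta l / 2)),
      sgn b * (sgn e * (√(D.rho l t) * Real.sin (D.theta l / 2)))⟩
  | .inr (.inr (i, e)) => ⟨0, sgn e * √(D.zeta i)⟩

/-- The label of a position. -/
def code (u : Fin D.p → ℕ) (μ : ∀ l, Fin (D.s l) → ℕ) : D.Idx → D.Label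
  | .inl ⟨i, j⟩ => .inl (i, decide ((j : ℕ) < u i))
  | .inr (.inl ⟨l, t, j, e⟩) => .inr (.inl (⟨l, t⟩, decide ((j : ℕ) < μ l t), decide (e = 0)))
  | .inr (.inr ⟨i, _, e⟩) => .inr (.inr (i, decide (e = 0)))

/-- The multiplicity prescribed for a label. -/
def labelMult (u : Fin D.p → ℕ) (μ : ∀ l, Fin (D.s l) → ℕ) : D.Label → ℕ
  | .inl (i, b) => if b then u i else D.h i - u i
  | .inr (.inl (⟨l, t⟩, b, _)) => if b then μ l t else D.m l t - μ l t
  | .inr (.inr (i, _)) => D.k i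

open Polynomial in
theorem charpoly_aux (u : Fin D.p → ℕ) (μ : ∀ l, Fin (D.s l) → ℕ) :
    (D.aux hD u μ).charpoly.map (algebraMap ℝ ℂ) =
      ∏ x : D.Idx, (X - C (D.rootVal (D.code u μ x))) := by
  rw [aux, charpoly_directSum]
  simp only [Polynomial.map_mul, Polynomial.map_prod, Fintype.prod_sum_type, Fintype.prod_sigma,
    Fin.prod_univ_two]
  congr 1
  · refine Finset.prod_congr rfl fun i _ => ?_
    rw [← Matrix.diagonal_smul, Matrix.charpoly_diagonal, Polynomial.map_prod]
    refine Finset.prod_congr rfl fun j _ => ?_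
    simp only [Polynomial.map_sub, map_X, map_C, code, rootVal, sgn]
    congr 2
    by_cases hj : (j : ℕ) < u i <;> apply Complex.ext <;> simp [hj]
  congr 1
  · refine Finset.prod_congr rfl fun l _ => Finset.prod_congr rfl fun t _ =>
      Finset.prod_congr rfl fun j _ => ?_
    by_cases hj : (j : ℕ) < μ l t
    · simp only [hj, if_true, charpoly_smul_rot, code, rootVal, sgn]
      simp
    · simp only [hj, if_false, charpoly_smul_rot, code, rootVal, sgn]
      simp [Real.cos_sub_pi, Real.sin_sub_pi]
  · refine Finset.prod_congr rfl fun i _ => Finset.prod_congr rfl fun j _ => ?_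
    simp only [charpoly_smul_rot, code, rootVal, sgn]
    simp

theorem _root_.Fin.sum_decide_lt_eq {m u : ℕ} (hu : u ≤ m) (b : Bool) :
    (∑ j : Fin m, if decide ((j : ℕ) < u) = b then 1 else 0) = if b then u else m - u := by
  have h := Fin.card_filter_val_lt (n := m) (m := u)
  rw [min_eq_right hu] at h
  rw [← Finset.card_filter]
  cases b
  · have h2 := Finset.card_filter_add_card_filter_not (s := Finset.univ)
      (fun j : Fin m => (j : ℕ) < u)
    simp only [Finset.card_univ, Fintype.card_fin] at h2
    simp only [decide_eq_false_iff_not, Bool.false_eq_true, if_false]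
    omega
  · simpa using h

theorem card_code {u : Fin D.p → ℕ} (hu : ∀ i, u i ≤ D.h i) {μ : ∀ l, Fin (D.s l) → ℕ}
    (hμ : ∀ l t, μ l t ≤ D.m l t) (τ : D.Label) :
    (Finset.univ.filter fun x => D.code u μ x = τ).card = D.labelMult u μ τ := by
  rw [Finset.card_filter]
  simp only [Fintype.sum_sum_type, Fintype.sum_sigma, Fin.sum_univ_two]
  rcases τ with ⟨i, b⟩ | ⟨⟨l, t⟩, b, e⟩ | ⟨i, e⟩
  · simp only [code, labelMult, reduceCtorEq, if_false, Finset.sum_const_zero, add_zero,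
      Sum.inl.injEq, Prod.mk.injEq]
    rw [Fintype.sum_eq_single i fun i' hi => by simp [hi]]
    simpa using Fin.sum_decide_lt_eq (hu i) b
  · simp only [code, labelMult, reduceCtorEq, if_false, Finset.sum_const_zero, add_zero,
      zero_add, Sum.inl.injEq, Sum.inr.injEq, Prod.mk.injEq, Sigma.mk.injEq]
    rw [Fintype.sum_eq_single l fun l' hl => by simp [hl],
      Fintype.sum_eq_single t fun t' ht => by simp [ht]]
    rw [← Fin.sum_decide_lt_eq (hμ l t) b]
    cases e <;> simp
  · simp only [code, labelMult, reduceCtorEq, if_false, Finset.sum_const_zero, add_zero,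
      zero_add, Sum.inr.injEq, Prod.mk.injEq]
    rw [Fintype.sum_eq_single i fun i' hi => by simp [hi]]
    cases e <;> simp

theorem sgn_inj {a b : Bool} {x y : ℝ} (hx : 0 < x) (hy : 0 < y) (h : sgn a * x = sgn b * y) :
    a = b ∧ x = y := by
  cases a <;> cases b <;> simp [sgn] at h ⊢ <;> linarith

theorem sgn_ne {a : Bool} {x : ℝ} (hx : 0 < x) : sgn a * x ≠ 0 := by
  cases a <;> simp [sgn, hx.ne']

variable {D}

/-- As `0 < θ / 2 < π / 2`, both its cosine and its sine are positive. Hence the vanishing of the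
real or imaginary part tells the three families apart, the signs recover the Booleans, and the
absolute values recover the modulus and the angle. -/
theorem rootVal_injective (h : D.Valid) : Function.Injective D.rootVal := by
  have hl := fun i => Real.sqrt_pos.2 (h.lam_pos i)
  have hr := fun l t => Real.sqrt_pos.2 (h.rho_pos l t)
  have hz := fun i => Real.sqrt_pos.2 (h.zeta_pos i)
  have hc : ∀ l, 0 < Real.cos (D.theta l / 2) := fun l =>
    Real.cos_pos_of_mem_Ioo ⟨by linarith [h.theta_pos l, Real.pi_pos], by
      linarith [h.theta_lt l]⟩
  have hs : ∀ l, 0 < Real.sin (D.theta l / 2) := fun l =>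
    Real.sin_pos_of_pos_of_lt_pi (by linarith [h.theta_pos l]) (by
      linarith [h.theta_lt l, Real.pi_pos])
  have hrc := fun l t => mul_pos (hr l t) (hc l)
  have hrs := fun l t => mul_pos (hr l t) (hs l)
  rintro (⟨i, b⟩ | ⟨⟨l, t⟩, b, e⟩ | ⟨i, e⟩) (⟨i', b'⟩ | ⟨⟨l', t'⟩, b', e'⟩ | ⟨i', e'⟩) heq <;>
    simp only [rootVal, Complex.mk.injEq] at heq
  · obtain ⟨rfl, h2⟩ := sgn_inj (hl _) (hl _) heq.1
    rw [Real.sqrt_inj (h.lam_pos _).le (h.lam_pos _).le] at h2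
    rw [h.lam_inj h2]
  · exact absurd heq.2.symm (mul_ne_zero
      (by cases b' <;> simp [sgn]) (sgn_ne (hrs _ _)))
  · exact absurd heq.1 (sgn_ne (hl _))
  · exact absurd heq.2 (mul_ne_zero
      (by cases b <;> simp [sgn]) (sgn_ne (hrs _ _)))
  · obtain ⟨rfl, h1⟩ := sgn_inj (hrc _ _) (hrc _ _) heq.1
    have h2 := mul_left_cancel₀ (by cases b <;> simp [sgn]) heq.2
    obtain ⟨rfl, h3⟩ := sgn_inj (hrs _ _) (hrs _ _) h2
    have hsq : √(D.rho l t) ^ 2 = √(D.rho l' t') ^ 2 := by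
      have e1 := Real.sin_sq_add_cos_sq (D.theta l / 2)
      have e2 := Real.sin_sq_add_cos_sq (D.theta l' / 2)
      calc _ = (√(D.rho l t) * Real.cos (D.theta l / 2)) ^ 2 +
            (√(D.rho l t) * Real.sin (D.theta l / 2)) ^ 2 := by
              linear_combination (-√(D.rho l t) ^ 2) * e1
        _ = _ := by rw [h1, h3]; linear_combination (√(D.rho l' t') ^ 2) * e2
    have hρ : √(D.rho l t) = √(D.rho l' t') :=
      (pow_left_inj₀ (hr _ _).le (hr _ _).le two_ne_zero).1 hsq
    have hcos : Real.cos (D.theta l / 2) = Real.cos (D.theta l' / 2) := by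
      rw [hρ] at h1
      exact mul_left_cancel₀ (hr _ _).ne' h1
    have hmem : ∀ l, D.theta l / 2 ∈ Set.Icc 0 Real.pi := fun l =>
      ⟨by linarith [h.theta_pos l], by linarith [h.theta_lt l, Real.pi_pos]⟩
    have hθ := Real.injOn_cos (hmem l) (hmem l') hcos
    obtain rfl : l = l' := h.theta_inj (by linarith)
    rw [Real.sqrt_inj (h.rho_pos _ _).le (h.rho_pos _ _).le] at hρ
    rw [h.rho_inj l hρ]
  · exact absurd heq.1 (sgn_ne (hrc _ _))
  · exact absurd heq.1.symm (sgn_ne (hl _))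
  · exact absurd heq.1.symm (sgn_ne (hrc _ _))
  · obtain ⟨rfl, h2⟩ := sgn_inj (hz _) (hz _) heq.2
    rw [Real.sqrt_inj (h.zeta_pos _).le (h.zeta_pos _).le] at h2
    rw [h.zeta_inj h2]

end EigData

end SqrtStrata

/-! ### The stratum in terms of the characteristic polynomial -/

namespace SqrtStrata

open Polynomial

variable {n : ℕ}

theorem mult_eq_count (A : Matrix (Fin n) (Fin n) ℝ) (z : ℂ) :
    mult A z = (A.charpoly.map (algebraMap ℝ ℂ)).roots.count z := by
  classical
  rw [count_roots, mult]

/-- A matrix whose eigenvalues have the same multiplicities as those of `A`, at the eigenvalues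
of `A`, has the same characteristic polynomial as `A`. -/
theorem charpoly_eq_of_mult_eq {A Y : Matrix (Fin n) (Fin n) ℝ}
    (h : ∀ z, mult A z ≠ 0 → mult Y z = mult A z) : Y.charpoly = A.charpoly := by
  classical
  apply Polynomial.map_injective _ (algebraMap ℝ ℂ).injective
  have hs : ∀ B : Matrix (Fin n) (Fin n) ℝ, (B.charpoly.map (algebraMap ℝ ℂ)).roots.card = n := by
    intro B
    rw [IsAlgClosed.card_roots_eq_natDegree, natDegree_map, Matrix.charpoly_natDegree_eq_dim,
      Fintype.card_fin]
  have hp : ∀ B : Matrix (Fin n) (Fin n) ℝ,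
      ((B.charpoly.map (algebraMap ℝ ℂ)).roots.map fun a => X - C a).prod =
        B.charpoly.map (algebraMap ℝ ℂ) := fun B =>
    prod_multiset_X_sub_C_of_monic_of_roots_card_eq (B.charpoly_monic.map _)
      (IsAlgClosed.card_roots_eq_natDegree)
  have hr : (A.charpoly.map (algebraMap ℝ ℂ)).roots = (Y.charpoly.map (algebraMap ℝ ℂ)).roots := by
    -- The roots of `A` form a sub-multiset of those of `Y`, and both have `n` elements, so nothing
    -- has to be assumed at other values.
    refine Multiset.eq_of_le_of_card_le (Multiset.le_iff_count.2 fun z => ?_) (by rw [hs, hs])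
    have h1 := h z
    rw [mult_eq_count, mult_eq_count] at h1
    by_cases h0 : (A.charpoly.map (algebraMap ℝ ℂ)).roots.count z = 0
    · simp [h0]
    · exact (h1 h0).ge
  rw [← hp Y, ← hp A, hr]

namespace EigData

variable {D : EigData} (hD : D.order = n)

theorem mult_aux (u : Fin D.p → ℕ) (μ : ∀ l, Fin (D.s l) → ℕ) (z : ℂ) :
    mult (D.aux hD u μ) z =
      (Finset.univ.filter fun x => D.rootVal (D.code u μ x) = z).card := by
  classical
  rw [mult_eq_count, charpoly_aux]
  have h : (∏ x : D.Idx, (X - C (D.rootVal (D.code u μ x)))).roots =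
      Finset.univ.val.map fun x => D.rootVal (D.code u μ x) := by
    refine Eq.trans ?_ (roots_multiset_prod_X_sub_C (Finset.univ.val.map _))
    rw [Multiset.map_map]
    rfl
  rw [h, Multiset.count_map]
  simp only [Finset.card, Finset.filter_val, eq_comm]

theorem mult_aux_rootVal (h : D.Valid) {u : Fin D.p → ℕ} (hu : ∀ i, u i ≤ D.h i)
    {μ : ∀ l, Fin (D.s l) → ℕ} (hμ : ∀ l t, μ l t ≤ D.m l t) (τ : D.Label) :
    mult (D.aux hD u μ) (D.rootVal τ) = D.labelMult u μ τ := by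
  rw [mult_aux, ← D.card_code hu hμ]
  simp only [(rootVal_injective h).eq_iff]

/-- The labelled values exhaust the roots of the auxiliary form, so prescribing their multiplicities
leaves no room for further eigenvalues of `Y`. -/
theorem charpoly_eq_aux_iff (h : D.Valid) {u : Fin D.p → ℕ} (hu : ∀ i, u i ≤ D.h i)
    {μ : ∀ l, Fin (D.s l) → ℕ} (hμ : ∀ l t, μ l t ≤ D.m l t) (Y : Matrix (Fin n) (Fin n) ℝ) :
    Y.charpoly = (D.aux hD u μ).charpoly ↔
      ∀ τ, mult Y (D.rootVal τ) = D.labelMult u μ τ := by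
  constructor
  · intro hY τ
    rw [← mult_aux_rootVal hD h hu hμ, mult, hY, mult]
  · refine fun hY => charpoly_eq_of_mult_eq fun z hz => ?_
    rw [mult_aux, Finset.card_ne_zero] at hz
    obtain ⟨x, hx⟩ := hz
    rw [← (Finset.mem_filter.1 hx).2, hY, mult_aux_rootVal hD h hu hμ]

/-- The listed eigenvalues, in the notation of the definition of the strata. -/
theorem forall_label_iff (u : Fin D.p → ℕ) (μ : ∀ l, Fin (D.s l) → ℕ)
    (Y : Matrix (Fin n) (Fin n) ℝ) :
    (∀ τ, mult Y (D.rootVal τ) = D.labelMult u μ τ) ↔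
      (∀ i, mult Y ((√(D.lam i) : ℝ) : ℂ) = u i ∧
        mult Y ((-√(D.lam i) : ℝ) : ℂ) = D.h i - u i) ∧
      (∀ l t, ∀ ε : ℝ, ε = 1 ∨ ε = -1 →
        mult Y ((√(D.rho l t) : ℝ) *
          Complex.exp (Complex.I * ((ε * (D.theta l / 2) : ℝ) : ℂ))) = μ l t ∧
        mult Y ((√(D.rho l t) : ℝ) *
          Complex.exp (Complex.I * ((ε * (D.theta l / 2 - Real.pi) : ℝ) : ℂ))) =
            D.m l t - μ l t) ∧
      (∀ i, ∀ ε : ℝ, ε = 1 ∨ ε = -1 →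
        mult Y (((ε * √(D.zeta i) : ℝ) : ℂ) * Complex.I) = D.k i) := by
  have e1 : ∀ i, D.rootVal (.inl (i, true)) = ((√(D.lam i) : ℝ) : ℂ) := fun i => by
    apply Complex.ext <;> simp [rootVal, sgn]
  have e2 : ∀ i, D.rootVal (.inl (i, false)) = ((-√(D.lam i) : ℝ) : ℂ) := fun i => by
    apply Complex.ext <;> simp [rootVal, sgn]
  have hexp : ∀ r a : ℝ, ((r : ℝ) : ℂ) * Complex.exp (Complex.I * (a : ℂ)) =
      ⟨r * Real.cos a, r * Real.sin a⟩ := fun r a => by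
    rw [mul_comm Complex.I]
    apply Complex.ext <;> simp [Complex.exp_ofReal_mul_I_re, Complex.exp_ofReal_mul_I_im]
  have e3 : ∀ l t e, D.rootVal (.inr (.inl (⟨l, t⟩, true, e))) = ((√(D.rho l t) : ℝ) *
      Complex.exp (Complex.I * ((sgn e * (D.theta l / 2) : ℝ) : ℂ))) := fun l t e => by
    rw [hexp]
    cases e <;> simp [rootVal, sgn]
  have e4 : ∀ l t e, D.rootVal (.inr (.inl (⟨l, t⟩, false, e))) = ((√(D.rho l t) : ℝ) *
      Complex.exp (Complex.I * ((sgn e * (D.theta l / 2 - Real.pi) : ℝ) : ℂ))) :=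
    fun l t e => by
    rw [hexp]
    cases e
    · simp [rootVal, sgn, ← Real.cos_neg (Real.pi - _), Real.cos_sub_pi, Real.sin_pi_sub]
    · simp [rootVal, sgn, Real.cos_sub_pi, Real.sin_sub_pi]
  have e5 : ∀ i e, D.rootVal (.inr (.inr (i, e))) =
      (((sgn e * √(D.zeta i) : ℝ) : ℂ) * Complex.I) := fun i e => by
    apply Complex.ext <;> simp [rootVal]
  -- The signs `ε = ± 1` of the definition of the stratum are the values of `sgn`.
  have hε : ∀ p : ℝ → Prop, (∀ ε, ε = 1 ∨ ε = -1 → p ε) ↔ ∀ e, p (sgn e) := fun p =>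
    ⟨fun h e => h _ (by cases e <;> simp [sgn]), by
      rintro h _ (rfl | rfl)
      · exact h true
      · exact h false⟩
  simp only [hε]
  constructor
  · intro h
    refine ⟨fun i => ⟨?_, ?_⟩, fun l t e => ⟨?_, ?_⟩, fun i e => ?_⟩
    · rw [← e1, h]; rfl
    · rw [← e2, h]; rfl
    · rw [← e3, h]; rfl
    · rw [← e4, h]; rfl
    · rw [← e5, h]; rfl
  · rintro ⟨h1, h2, h3⟩ (⟨i, _ | _⟩ | ⟨⟨l, t⟩, _ | _, e⟩ | ⟨i, e⟩)
    · rw [e2, (h1 i).2]; rfl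
    · rw [e1, (h1 i).1]; rfl
    · rw [e4, (h2 l t e).2]; rfl
    · rw [e3, (h2 l t e).1]; rfl
    · rw [e5, h3 i e]; rfl

end EigData

theorem valid_eigData (A : Matrix (Fin n) (Fin n) ℝ) : (eigData A).Valid := by
  classical
  have hinj : ∀ s : Finset ℝ, Function.Injective (s.orderEmbOfFin rfl) := fun s =>
    (s.orderEmbOfFin rfl).injective
  have harg : ∀ l, ∃ z : ℂ, 0 < z.im ∧ z.arg = (eigData A).theta l := by
    intro l
    have h := Finset.orderEmbOfFin_mem (upperArgs A) rfl l
    unfold upperArgs upperEig at h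
    obtain ⟨z, hz, hz'⟩ := Finset.mem_image.1 h
    exact ⟨z, (Finset.mem_filter.1 hz).2, hz'⟩
  refine ⟨hinj _, fun i => ?_, hinj _, fun l => ?_, fun l => ?_, fun l => hinj _, fun l t => ?_,
    hinj _, fun i => ?_⟩
  · have h := Finset.orderEmbOfFin_mem (posEig A) rfl i
    unfold posEig at h
    obtain ⟨z, hz, hz'⟩ := Finset.mem_image.1 h
    exact (Finset.mem_filter.1 hz).2.2.trans_eq hz'
  · obtain ⟨z, hz, hz'⟩ := harg l
    rw [← hz']
    refine lt_of_le_of_ne (Complex.arg_nonneg_iff.2 hz.le) fun h => ?_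
    exact hz.ne' (Complex.arg_eq_zero_iff.1 h.symm).2
  · obtain ⟨z, hz, hz'⟩ := harg l
    rw [← hz']
    exact Complex.arg_lt_pi_iff.2 (Or.inr hz.ne')
  · have h := Finset.orderEmbOfFin_mem
      (upperNorms A ((upperArgs A).orderEmbOfFin rfl l)) rfl t
    unfold upperNorms upperEig at h
    obtain ⟨z, hz, hz'⟩ := Finset.mem_image.1 h
    have hz2 := (Finset.mem_filter.1 (Finset.mem_filter.1 hz).1).2
    refine lt_of_lt_of_eq (norm_pos_iff.2 fun h0 => ?_) hz'
    simp [h0] at hz2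
  · have h := Finset.orderEmbOfFin_mem (negEig A) rfl i
    unfold negEig at h
    obtain ⟨z, hz, hz'⟩ := Finset.mem_image.1 h
    have := (Finset.mem_filter.1 hz).2.2
    refine lt_of_lt_of_eq ?_ hz'
    linarith

/-- The list of eigenvalue conditions becomes one equation between characteristic polynomials, which
is visibly invariant under conjugation. -/
theorem mem_stratum_iff (M : GL (Fin n) ℝ)
    (hM : ∀ x : ℝ, x < 0 → Even (mult (M : Matrix (Fin n) (Fin n) ℝ) x))
    {u : Fin (eigData (M : Matrix (Fin n) (Fin n) ℝ)).p → ℕ}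
    (hu : ∀ i, u i ≤ (eigData (M : Matrix (Fin n) (Fin n) ℝ)).h i)
    {μ : ∀ l, Fin ((eigData (M : Matrix (Fin n) (Fin n) ℝ)).s l) → ℕ}
    (hμ : ∀ l t, μ l t ≤ (eigData (M : Matrix (Fin n) (Fin n) ℝ)).m l t)
    (Y : Matrix (Fin n) (Fin n) ℝ) :
    Y ∈ stratum (M : Matrix (Fin n) (Fin n) ℝ) u μ ↔
      Y * Y = M ∧ Y.charpoly = (rja M hM u μ).charpoly := by
  rw [rja, EigData.charpoly_eq_aux_iff _ (valid_eigData _) hu hμ, EigData.forall_label_iff,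
    ← pow_two]
  rfl

theorem rja_mul_self (M : GL (Fin n) ℝ)
    (hM : ∀ x : ℝ, x < 0 → Even (mult (M : Matrix (Fin n) (Fin n) ℝ) x))
    (u : Fin (eigData (M : Matrix (Fin n) (Fin n) ℝ)).p → ℕ)
    (μ : ∀ l, Fin ((eigData (M : Matrix (Fin n) (Fin n) ℝ)).s l) → ℕ) :
    rja M hM u μ * rja M hM u μ = rjs M hM :=
  EigData.aux_mul_self _ (valid_eigData _) u μ

theorem mem_comm_iff {B : Matrix (Fin n) (Fin n) ℝ} {X : GL (Fin n) ℝ} :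
    X ∈ comm B ↔ B * X = X * B := by
  change ⁅B, (X : Matrix (Fin n) (Fin n) ℝ)⁆ = 0 ↔ _
  rw [← commute_iff_lie_eq]
  rfl

/-- Square roots of a semisimple nonsingular matrix with the same characteristic polynomial are
conjugate under the centralizer of this matrix. -/
theorem exists_conj_of_sq_eq {M Y B : GL (Fin n) ℝ}
    (hss : Module.End.IsSemisimple (Matrix.toLin' (M : Matrix (Fin n) (Fin n) ℝ)))
    (hY : Y * Y = M) (hB : B * B = M)
    (h : (Y : Matrix (Fin n) (Fin n) ℝ).charpoly = (B : Matrix (Fin n) (Fin n) ℝ).charpoly) :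
    ∃ Q : GL (Fin n) ℝ, Q * M = M * Q ∧ Y = Q * B * Q⁻¹ := by
  have hY' : (Y : Matrix (Fin n) (Fin n) ℝ) * Y = M := congrArg Units.val hY
  have hB' : (B : Matrix (Fin n) (Fin n) ℝ) * B = M := congrArg Units.val hB
  obtain ⟨P, hP⟩ := Matrix.exists_conj_of_charpoly_eq
    (Matrix.isSemisimple_of_sq M.isUnit hss hY') (Matrix.isSemisimple_of_sq M.isUnit hss hB')
    (by rw [Matrix.charpoly_map, Matrix.charpoly_map, h])
  obtain ⟨Q, hQ⟩ := Matrix.exists_real_conj P hP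
  have hQ' : Y * Q = Q * B := Units.ext hQ
  refine ⟨Q, ?_, eq_mul_inv_of_mul_eq hQ'⟩
  -- No choice of `Q` is needed: `Y = Q B Q⁻¹` and `Y ^ 2 = B ^ 2 = M` already force `Q` to commute
  -- with `M`.
  nth_rewrite 1 [← hB]
  rw [← hY, ← mul_assoc, ← hQ', mul_assoc, ← hQ', mul_assoc]

/-- Over the infinite field `ℝ`, polynomials agree when their values do, so the second condition is
the intersection over real `t` of the closed conditions `det (t - Y) = det (t - B)`. -/
theorem isClosed_sq_eq_charpoly_eq (M B : Matrix (Fin n) (Fin n) ℝ) :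
    IsClosed {Y : GL (Fin n) ℝ | (Y : Matrix (Fin n) (Fin n) ℝ) * Y = M ∧
      (Y : Matrix (Fin n) (Fin n) ℝ).charpoly = B.charpoly} := by
  have hv : Continuous fun Y : GL (Fin n) ℝ => (Y : Matrix (Fin n) (Fin n) ℝ) :=
    Units.continuous_val
  have h : {Y : GL (Fin n) ℝ | (Y : Matrix (Fin n) (Fin n) ℝ) * Y = M ∧
      (Y : Matrix (Fin n) (Fin n) ℝ).charpoly = B.charpoly} =
      {Y : GL (Fin n) ℝ | (Y : Matrix (Fin n) (Fin n) ℝ) * Y = M} ∩ ⋂ t : ℝ,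
        {Y : GL (Fin n) ℝ | (Matrix.scalar (Fin n) t - (Y : Matrix (Fin n) (Fin n) ℝ)).det =
          (Matrix.scalar (Fin n) t - B).det} := by
    ext Y
    simp only [Set.mem_ofPred_eq, Set.mem_inter_iff, Set.mem_iInter, ← Matrix.eval_charpoly]
    exact and_congr_right fun _ => ⟨fun h t => by rw [h], Polynomial.funext⟩
  rw [h]
  refine (isClosed_eq (hv.mul hv) continuous_const).inter (isClosed_iInter fun t => ?_)
  exact isClosed_eq (continuous_const.sub hv).matrix_det continuous_const

end SqrtStrata

/-! ### The stratum as an orbit -/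

theorem proposition2p4 {n : ℕ} (M C : GL (Fin n) ℝ)
    (hss : Module.End.IsSemisimple (Matrix.toLin' (M : Matrix (Fin n) (Fin n) ℝ)))
    (hneg : ∀ x : ℝ, x < 0 → Even (SqrtStrata.mult (M : Matrix (Fin n) (Fin n) ℝ) x))
    (hC : (M : Matrix (Fin n) (Fin n) ℝ) = SqrtStrata.conj C (SqrtStrata.rjs M hneg))
    (u : Fin (SqrtStrata.eigData (M : Matrix (Fin n) (Fin n) ℝ)).p → ℕ)
    (hu : ∀ i, u i ≤ (SqrtStrata.eigData (M : Matrix (Fin n) (Fin n) ℝ)).h i)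
    (μ : ∀ l, Fin ((SqrtStrata.eigData (M : Matrix (Fin n) (Fin n) ℝ)).s l) → ℕ)
    (hμ : ∀ l t, μ l t ≤ (SqrtStrata.eigData (M : Matrix (Fin n) (Fin n) ℝ)).m l t)
    (S : Set (GL (Fin n) ℝ))
    (hS : S = {Y : GL (Fin n) ℝ | (Y : Matrix (Fin n) (Fin n) ℝ) ∈
      SqrtStrata.stratum (M : Matrix (Fin n) (Fin n) ℝ) u μ})
    (G K : Subgroup (GL (Fin n) ℝ))
    (hG : G = SqrtStrata.comm (SqrtStrata.rjs M hneg))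
    (hK : K = SqrtStrata.comm (SqrtStrata.rja M hneg u μ)) :
    -- the two descriptions of the stratum
    (SqrtStrata.stratum (M : Matrix (Fin n) (Fin n) ℝ) u μ =
        {Y | ∃ X ∈ G, Y = (C : Matrix (Fin n) (Fin n) ℝ) * (X : Matrix (Fin n) (Fin n) ℝ) *
          SqrtStrata.rja M hneg u μ * ((X⁻¹ : GL (Fin n) ℝ) : Matrix (Fin n) (Fin n) ℝ) *
          ((C⁻¹ : GL (Fin n) ℝ) : Matrix (Fin n) (Fin n) ℝ)}) ∧
    (SqrtStrata.stratum (M : Matrix (Fin n) (Fin n) ℝ) u μ =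
        SqrtStrata.conj C '' {Z | ∃ X ∈ G, Z = SqrtStrata.conj X (SqrtStrata.rja M hneg u μ)}) ∧
    -- it consists of nonsingular matrices and is closed in `GL_n`
    (∀ Y ∈ SqrtStrata.stratum (M : Matrix (Fin n) (Fin n) ℝ) u μ, IsUnit Y) ∧
    IsClosed S ∧
    -- it is an embedded submanifold, diffeomorphic to the homogeneous space `G / K`
    K ≤ G ∧
    ∃ (d a b : ℕ) (_ : ChartedSpace (EuclideanSpace ℝ (Fin d)) S)
      (_ : ChartedSpace (EuclideanSpace ℝ (Fin a)) G)
      (_ : ChartedSpace (EuclideanSpace ℝ (Fin b)) (G ⧸ K.subgroupOf G)),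
      SqrtStrata.IsEmbeddedSubmanifold (d := d) S ∧
      SqrtStrata.IsLieSubgroup (a := a) G ∧
      SqrtStrata.IsHomogeneousSpace (a := a) (b := b) (K.subgroupOf G) ∧
      Nonempty (Diffeomorph (𝓡 d) (𝓡 b) S (G ⧸ K.subgroupOf G) ∞) := by
  have hJ := SqrtStrata.rja_mul_self M hneg u μ
  have hmem := SqrtStrata.mem_stratum_iff M hneg hu hμ
  set J := SqrtStrata.rjs M hneg
  set B := SqrtStrata.rja M hneg u μ
  have hJC : J = (C⁻¹ * M * C : GL (Fin n) ℝ) := by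
    simp [hC, SqrtStrata.conj, mul_assoc]
  obtain ⟨A, hA⟩ : IsUnit B := by
    have h : IsUnit (B * B) := by
      rw [hJ, hJC]
      exact Units.isUnit _
    exact ((Commute.refl B).isUnit_mul_iff.1 h).1
  have hAA : A * A = C⁻¹ * M * C := by
    apply Units.ext
    rw [Units.val_mul, hA, hJ, hJC]
  have hGA : G = AntiSplitting.grp A := by
    ext X
    rw [hG, SqrtStrata.mem_comm_iff, AntiSplitting.mem_grp, hA, hJ]
  have hKA : K = Subgroup.centralizer {A} := by
    ext X
    rw [hK, SqrtStrata.mem_comm_iff, Subgroup.mem_centralizer_singleton_iff, eq_comm,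
      Units.ext_iff, Units.val_mul, Units.val_mul, hA]
  have horbit : ∀ Y : Matrix (Fin n) (Fin n) ℝ,
      Y ∈ SqrtStrata.stratum (M : Matrix (Fin n) (Fin n) ℝ) u μ ↔
        ∃ X ∈ G, Y = (C * X * A * X⁻¹ * C⁻¹ : GL (Fin n) ℝ) := by
    intro Y
    rw [hmem]
    constructor
    · rintro ⟨h1, h2⟩
      obtain ⟨Y, rfl⟩ : IsUnit Y := by
        have h : IsUnit (Y * Y) := h1 ▸ M.isUnit
        exact ((Commute.refl Y).isUnit_mul_iff.1 h).1
      -- The reference square root of `M` is `C A C⁻¹`. As `Q` commutes with `M`, its conjugate `C⁻¹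
      -- Q C` commutes with `C⁻¹ M C = A ^ 2` and is the required element of `G`.
      obtain ⟨Q, hQ, hYQ⟩ := SqrtStrata.exists_conj_of_sq_eq (B := C * A * C⁻¹) hss
        (Units.ext h1)
        (by
          calc _ = C * (A * A) * C⁻¹ := by group
            _ = M := by rw [hAA]; group)
        (by rw [h2, Units.val_mul, Units.val_mul, Matrix.coe_units_inv,
          Matrix.charpoly_units_conj, hA])
      refine ⟨C⁻¹ * Q * C, ?_, ?_⟩
      · rw [hGA, Subgroup.mem_centralizer_singleton_iff, pow_two, hAA]
        calc _ = C⁻¹ * (Q * M) * C := by group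
          _ = _ := by rw [hQ]; group
      · rw [hYQ]
        congr 1
        group
    · rintro ⟨X, hX, rfl⟩
      rw [hGA, Subgroup.mem_centralizer_singleton_iff, pow_two] at hX
      refine ⟨?_, ?_⟩
      · rw [← Units.val_mul, ← Units.ext_iff]
        calc _ = C * (X * (A * A)) * X⁻¹ * C⁻¹ := by group
          _ = C * (A * A) * C⁻¹ := by rw [hX]; group
          _ = M := by rw [hAA]; group
      · have e : C * X * A * X⁻¹ * C⁻¹ = (C * X) * A * (C * X)⁻¹ := by group
        rw [e, Units.val_mul, Units.val_mul, Matrix.coe_units_inv, Matrix.charpoly_units_conj, hA]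
  have hSA : S = AntiSplitting.orbit A C := by
    ext Y
    rw [hS, Set.mem_ofPred_eq, horbit, hGA]
    exact exists_congr fun X => and_congr_right fun _ => Units.ext_iff.symm
  refine ⟨?_, ?_, ?_, ?_, ?_, ?_⟩
  · ext Y
    rw [horbit, Set.mem_ofPred_eq]
    simp only [Units.val_mul, hA]
  · ext Y
    rw [horbit, Set.mem_image]
    simp only [Set.mem_ofPred_eq, SqrtStrata.conj, Units.val_mul, hA]
    constructor
    · rintro ⟨X, hX, rfl⟩
      exact ⟨_, ⟨X, hX, rfl⟩, by simp only [mul_assoc]⟩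
    · rintro ⟨_, ⟨X, hX, rfl⟩, rfl⟩
      exact ⟨X, hX, by simp only [mul_assoc]⟩
  · intro Y hY
    obtain ⟨X, -, rfl⟩ := (horbit Y).1 hY
    exact Units.isUnit _
  · rw [hS]
    simp only [hmem]
    exact SqrtStrata.isClosed_sq_eq_charpoly_eq _ _
  · rw [hGA, hKA]
    exact AntiSplitting.centralizer_le A
  · clear horbit hmem hS hG hK
    -- After substitution `K.subgroupOf G` is the stabilizer of `A`, and the goal is the general
    -- statement on orbits.
    subst hSA hGA hKA
    exact exists_orbit_structures A C
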